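/- Let $K$ be an algebraically closed field of any characteristic, let $n\ge 1$, and let $\mathbb G_m^n=(K\setminus\{0\})^n$ with coordinatewise multiplication. A subset of $\mathbb G_m^n$ is called algebraic if it is the set of common zeros in $\mathbb G_m^n$ of finitely many Laurent polynomials in $K[X_1^{\pm1},\dots,X_n^{\pm1}]$; the algebraic subsets are the closed sets of the Zariski topology, and irreducibility and (Krull) dimension are taken with respect to it. A torsion coset is a set $\boldsymbol\zeta G$, where $\boldsymbol\zeta\in\mathbb G_m^n$ has finite order and $G<\mathbb G_m^n$ is an irreducible algebraic subgroup. An algebraic set $X\subset\mathbb G_m^n$ is called admissible if it is finite, or if $\dim X\ge 1$ and $X$ contains no torsion coset of dimension $\dim X$. For real $T\ge 1$ let $X_T$ be the set of all $\boldsymbol\zeta\in X$ that have finite order at most $T$ in the group $\mathbb G_m^n$. Let $X\subset\mathbb G_m^n$ be algebraic, irreducible, admissible and of dimension $d$. Then there is a constant $c=c(X)$ such that for all real $T\ge 1$ the set $X_T$ is finite and $$\#X_T\le c\,T^{\,d+1-\frac1{d+1}}.$$ -/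

import Mathlib

namespace GmTorsion

/-- The group `𝔾ₘⁿ(K) = (K ∖ {0})ⁿ` of `K`-points of the `n`-dimensional algebraic torus, with
coordinatewise multiplication. -/
abbrev Torus (n : ℕ) (K : Type*) [Field K] : Type _ := Fin n → Kˣ

/-- The ring `K[X₁^{±1}, …, Xₙ^{±1}]` of Laurent polynomials: finitely supported families of
coefficients indexed by the exponents in `ℤⁿ`, with the convolution product. -/
abbrev Laurent (n : ℕ) (K : Type*) [Field K] : Type _ := AddMonoidAlgebra K (Fin n → ℤ)

/-- The value `x^v = x₁^{v₁} ⋯ xₙ^{vₙ}` of a monomial with exponent `v`, multiplicative in `v`. -/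
noncomputable def monomialHom {n : ℕ} {K : Type*} [Field K] (x : Torus n K) :
    Multiplicative (Fin n → ℤ) →* K where
  toFun v := ((∏ i, x i ^ (v.toAdd i) : Kˣ) : K)
  map_one' := by simp
  map_mul' v w := by simp [zpow_add, Finset.prod_mul_distrib]

/-- Evaluation of Laurent polynomials at a point of the torus. -/
noncomputable def eval {n : ℕ} {K : Type*} [Field K] (x : Torus n K) : Laurent n K →ₐ[K] K :=
  AddMonoidAlgebra.lift K K (Fin n → ℤ) (monomialHom x)

theorem eval_apply {n : ℕ} {K : Type*} [Field K] (x : Torus n K) (P : Laurent n K) :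
    eval x P = P.coeff.sum fun v a => a * ((∏ i, x i ^ v i : Kˣ) : K) := by
  simp [eval, AddMonoidAlgebra.lift_apply, monomialHom]

/-- Algebraic subsets of `𝔾ₘⁿ`: the common zero sets of finitely many Laurent polynomials. -/
def IsAlgebraic {n : ℕ} {K : Type*} [Field K] (X : Set (Torus n K)) : Prop :=
  ∃ S : Finset (Laurent n K), X = {x | ∀ P ∈ S, eval x P = 0}

theorem isNoetherianRing_laurent (n : ℕ) (K : Type*) [Field K] :
    IsNoetherianRing (Laurent n K) := by
  have : Algebra.FiniteType K (Laurent n K) := inferInstance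
  exact Algebra.FiniteType.isNoetherianRing K _

theorem isAlgebraic_zeroLocus {n : ℕ} {K : Type*} [Field K] (S : Set (Laurent n K)) :
    IsAlgebraic {x : Torus n K | ∀ P ∈ S, eval x P = 0} := by
  have := isNoetherianRing_laurent n K
  obtain ⟨F, hF⟩ := (isNoetherianRing_iff_ideal_fg _).1 this (Ideal.span S)
  have key : ∀ (A : Set (Laurent n K)) (x : Torus n K),
      (∀ P ∈ A, eval x P = 0) ↔ Ideal.span A ≤ RingHom.ker (eval x) := by
    intro A x
    rw [Ideal.span_le]
    rfl
  refine ⟨F, Set.ext fun x => ?_⟩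
  have h1 := key S x
  have h2 := key (F : Set (Laurent n K)) x
  simp only [Set.mem_ofPred_eq]
  rw [h1, ← hF, ← h2]
  rfl

theorem isAlgebraic_empty {n : ℕ} {K : Type*} [Field K] :
    IsAlgebraic (∅ : Set (Torus n K)) :=
  ⟨{1}, by ext x; simp⟩

theorem isAlgebraic_sInter {n : ℕ} {K : Type*} [Field K] (A : Set (Set (Torus n K)))
    (hA : A ⊆ {X | IsAlgebraic X}) : IsAlgebraic (⋂₀ A) := by
  convert isAlgebraic_zeroLocus {P : Laurent n K | ∃ X ∈ A, ∀ x ∈ X, eval x P = 0} using 1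
  ext x
  constructor
  · rintro hx P ⟨X, hX, hP⟩
    exact hP x (hx X hX)
  · intro hx X hX
    obtain ⟨S, rfl⟩ := hA hX
    intro P hP
    exact hx P ⟨_, hX, fun y hy => hy P hP⟩

theorem isAlgebraic_union {n : ℕ} {K : Type*} [Field K] (X : Set (Torus n K))
    (hX : IsAlgebraic X) (Y : Set (Torus n K)) (hY : IsAlgebraic Y) : IsAlgebraic (X ∪ Y) := by
  obtain ⟨S, rfl⟩ := hX
  obtain ⟨S', rfl⟩ := hY
  convert isAlgebraic_zeroLocus {R : Laurent n K | ∃ P ∈ S, ∃ Q ∈ S', R = P * Q} using 1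
  ext x
  constructor
  · rintro (hx | hx) R ⟨P, hP, Q, hQ, rfl⟩
    · simp [hx P hP]
    · simp [hx Q hQ]
  · intro hx
    by_contra hcon
    simp only [Set.mem_union, Set.mem_ofPred_eq, not_or, not_forall] at hcon
    obtain ⟨⟨P, hP, hP0⟩, Q, hQ, hQ0⟩ := hcon
    have := hx (P * Q) ⟨P, hP, Q, hQ, rfl⟩
    rw [map_mul] at this
    exact (mul_ne_zero hP0 hQ0) this

/-- The Zariski topology on `𝔾ₘⁿ`: the closed sets are exactly the algebraic subsets. -/
instance zariskiTopology (n : ℕ) (K : Type*) [Field K] : TopologicalSpace (Torus n K) :=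
  TopologicalSpace.ofClosed {X | IsAlgebraic X} isAlgebraic_empty isAlgebraic_sInter
    isAlgebraic_union

theorem isClosed_iff {n : ℕ} {K : Type*} [Field K] (X : Set (Torus n K)) :
    IsClosed X ↔ IsAlgebraic X := by
  rw [← isOpen_compl_iff]
  change Xᶜᶜ ∈ {X | IsAlgebraic X} ↔ _
  rw [compl_compl]
  rfl

/-- The dimension of a subset of `𝔾ₘⁿ`: the Krull dimension of the subspace, for the Zariski
topology. -/
noncomputable def dim {n : ℕ} {K : Type*} [Field K] (X : Set (Torus n K)) : WithBot ℕ∞ :=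
  topologicalKrullDim X

/-- A linear torus is an irreducible algebraic subgroup of `𝔾ₘⁿ`. -/
def IsLinearTorus {n : ℕ} {K : Type*} [Field K] (G : Subgroup (Torus n K)) : Prop :=
  IsAlgebraic (G : Set (Torus n K)) ∧ IsIrreducible (G : Set (Torus n K))

/-- A torsion coset is a translate `ζG` of a linear torus `G` by a torsion point `ζ`. -/
def IsTorsionCoset {n : ℕ} {K : Type*} [Field K] (C : Set (Torus n K)) : Prop :=
  ∃ (ζ : Torus n K) (G : Subgroup (Torus n K)),
    IsOfFinOrder ζ ∧ IsLinearTorus G ∧ C = (fun g => ζ * g) '' (G : Set (Torus n K))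

/-- A set is admissible if it is finite, or if it has positive dimension and contains no torsion
coset of the same dimension. -/
def IsAdmissible {n : ℕ} {K : Type*} [Field K] (X : Set (Torus n K)) : Prop :=
  X.Finite ∨ (1 ≤ dim X ∧ ∀ C : Set (Torus n K), IsTorsionCoset C → C ⊆ X → dim C ≠ dim X)

/-- The set `X_T` of torsion points in `X` of order at most `T`. -/
def torsionUpTo {n : ℕ} {K : Type*} [Field K] (X : Set (Torus n K)) (T : ℝ) :
    Set (Torus n K) :=
  {ζ | ζ ∈ X ∧ IsOfFinOrder ζ ∧ (orderOf ζ : ℝ) ≤ T}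

end GmTorsion

namespace GmTorsion

/-! Finite X is trivial, and so is X without torsion points. Otherwise admissibility says that X is
not a torsion coset. The characters constant on the irreducible set X form a saturated lattice, so
the others have a basis modulo it; were that basis algebraically independent on X, then X would be a
torsion coset (`exists_noConst_not_indep`). Hence some k monomials, multiplicatively independent
modulo constants, satisfy a relation f on X. Take k = p + 1 minimal, then f with fewest terms.
Minimality of k makes the first p monomials algebraically independent, so p ≤ d, and keeps the
support of f out of every affine hyperplane (`exists_fewer_of_homogeneous`). Minimality of f makes
its proper partial sums nonzero at generic points of X.

The saving comes from Dirichlet approximation (`exists_cochar`): a torsion point of order at most T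
in the k-dimensional torus lies on a coset ξ·t^a with ξ^g = 1, a primitive and g|a_i| ≤ Q =
2T^(1-1/k). If proper partial sums do not vanish, f restricts to a nonzero Laurent polynomial in t
of degree O(Q/g). There are O((Q/g)^k) vectors a and at most g^(k-1) cosets for each, so the count
is O(Q^(k+1) Σ 1/g²) = O(T^(k-1/k)) (`exists_properZeros_count`).

To return to X, extend the first p monomials to a maximal algebraically independent system of m ≤ d
monomials; its fibres are bounded off a proper closed set. At a point of order N the m - p new
coordinates are N-th roots of unity, which costs T^(m-p) (`exists_generic_bound`). The exponent is
m+1-1/(p+1) ≤ d+1-1/(d+1). The exceptional closed sets have dimension below d and contribute O(T^d)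
(`exists_torsionUpTo_bound`). -/

open TopologicalSpace

/-! ### Commutative algebra: primes that preserve algebraic independence -/

/-- Zariski's lemma, as a statement about single elements. -/
theorem isAlgebraic_of_isField {F S : Type*} [Field F] [CommRing S] [Algebra F S]
    [Algebra.FiniteType F S] (hS : IsField S) (s : S) : _root_.IsAlgebraic F s := by
  let := hS.toField
  have : Module.Finite F S := finite_of_finite_type_of_isJacobsonRing F S
  exact (IsIntegral.of_finite F s).isAlgebraic

/-- Cutting down a finitely generated domain: if `a` is transcendental over the algebra generated by
algebraically independent elements `x`, some nonzero prime keeps `x` algebraically independent. -/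
theorem exists_prime_algebraicIndependent {K R ι : Type*} [Field K] [CommRing R] [IsDomain R]
    [Algebra K R] [Algebra.FiniteType K R] {x : ι → R} (hx : AlgebraicIndependent K x) {a : R}
    (ha : Transcendental (Algebra.adjoin K (Set.range x)) a) :
    ∃ q : Ideal R, q.IsPrime ∧ q ≠ ⊥ ∧
      AlgebraicIndependent K fun i => Ideal.Quotient.mk q (x i) := by
  set A := Algebra.adjoin K (Set.range x) with hA
  -- Inverting the nonzero elements of K[x] turns R into a finitely generated algebra over F = Frac
  -- K[x]. By Zariski's lemma it is not a field, since a is transcendental; any nonzero prime of it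
  -- contracts to one that meets K[x] only in 0.
  let M := Algebra.algebraMapSubmonoid R (nonZeroDivisors A)
  have hM : M ≤ nonZeroDivisors R := by
    rintro _ ⟨b, hb, rfl⟩
    refine mem_nonZeroDivisors_of_ne_zero ?_
    have := nonZeroDivisors.ne_zero hb
    simpa using this
  let F := FractionRing A
  let S := Localization M
  have hinj : Function.Injective (algebraMap R S) := IsLocalization.injective S hM
  have : IsDomain S := IsLocalization.isDomain_localization hM
  have : Algebra.FiniteType A R := Algebra.FiniteType.of_restrictScalars_finiteType K A R
  let : Algebra F S := localizationAlgebra (nonZeroDivisors A) R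
  have : IsScalarTower A F S :=
    isScalarTower_localizationAlgebra (nonZeroDivisors A) R
  have : Algebra.FiniteType F S :=
    have : IsLocalization (Submonoid.map (algebraMap A R) (nonZeroDivisors A)) S :=
      Localization.isLocalization (M := M)
    RingHom.finiteType_localizationPreserves (algebraMap A R) (nonZeroDivisors A) F S
      (RingHom.finiteType_algebraMap.2 ‹_›)
  have hnf : ¬ IsField S := by
    intro hf
    have h1 : _root_.IsAlgebraic F (algebraMap R S a) := isAlgebraic_of_isField hf _
    have h2 : _root_.IsAlgebraic A (algebraMap R S a) :=
      (IsFractionRing.isAlgebraic_iff A F S).2 h1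
    exact ha ((isAlgebraic_algebraMap_iff hinj).1 h2)
  obtain ⟨p, hp0, hp⟩ := Ring.not_isField_iff_exists_prime.1 hnf
  refine ⟨p.comap (algebraMap R S), inferInstance, fun h => hp0 ?_, ?_⟩
  · have := IsLocalization.map_under M S p
    rw [← this, Ideal.under_def, h, Ideal.map_bot]
  · rw [algebraicIndependent_iff] at hx ⊢
    intro P hP
    refine hx P ?_
    by_contra hne
    have hmem : MvPolynomial.aeval x P ∈ p.comap (algebraMap R S) := by
      rw [← Ideal.Quotient.eq_zero_iff_mem, ← hP]
      exact MvPolynomial.comp_aeval_apply (φ := Ideal.Quotient.mkₐ K (p.comap (algebraMap R S))) x P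
    have hA' : MvPolynomial.aeval x P ∈ A := by
      rw [hA, Algebra.adjoin_range_eq_range_aeval]
      exact ⟨P, rfl⟩
    have hu : IsUnit (algebraMap R S (MvPolynomial.aeval x P)) := by
      refine IsLocalization.map_units S (⟨_, ⟨⟨_, hA'⟩, ?_, rfl⟩⟩ : M)
      exact mem_nonZeroDivisors_of_ne_zero fun h => hne (congrArg Subtype.val h)
    exact hp.ne_top (Ideal.eq_top_of_isUnit_mem _ hmem hu)

/-! ### Monomials, monomial maps and cocharacters -/

variable {K : Type*} [Field K]

/-- The value `x^u` of the monomial with exponent `u`, as a unit. -/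
def mon {n : ℕ} (x : Torus n K) (u : Fin n → ℤ) : Kˣ := ∏ i, x i ^ u i

/-- The monomial homomorphism `x ↦ (x^{A 0}, …, x^{A (k-1)})` of tori. -/
def monMap {k n : ℕ} (A : Fin k → Fin n → ℤ) (x : Torus n K) : Torus k K := fun i => mon x (A i)

section mon

variable {n k : ℕ} (x y : Torus n K) (u v : Fin n → ℤ)

@[simp] theorem mon_zero : mon x 0 = 1 := by simp [mon]

theorem mon_add : mon x (u + v) = mon x u * mon x v := by
  simp [mon, zpow_add, Finset.prod_mul_distrib]

theorem mon_neg : mon x (-u) = (mon x u)⁻¹ := by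
  simp [mon]

theorem mon_sub : mon x (u - v) = mon x u / mon x v := by
  rw [sub_eq_add_neg, mon_add, mon_neg, div_eq_mul_inv]

theorem mon_zsmul (c : ℤ) : mon x (c • u) = mon x u ^ c := by
  simp [mon, Finset.prod_zpow, zpow_mul, mul_comm c]

@[simp] theorem mon_one : mon (1 : Torus n K) u = 1 := by simp [mon]

theorem mon_mul : mon (x * y) u = mon x u * mon y u := by
  simp [mon, mul_zpow, Finset.prod_mul_distrib]

theorem mon_inv : mon x⁻¹ u = (mon x u)⁻¹ := by simp [mon]

theorem mon_pow (N : ℕ) : mon (x ^ N) u = mon x u ^ N := by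
  simp only [mon, Pi.pow_apply, ← Finset.prod_pow]
  refine Finset.prod_congr rfl fun i _ => ?_
  rw [← zpow_natCast, ← zpow_mul, mul_comm, zpow_mul, zpow_natCast]

theorem mon_single (i : Fin n) : mon x (Pi.single i 1) = x i := by
  rw [mon, Finset.prod_eq_single i]
  · simp
  · intro j _ hj
    simp [Pi.single_eq_of_ne hj]
  · simp

theorem mon_sum {ι : Type*} (s : Finset ι) (f : ι → Fin n → ℤ) :
    mon x (∑ i ∈ s, f i) = ∏ i ∈ s, mon x (f i) := by
  classical
  induction s using Finset.induction_on with
  | empty => simp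
  | insert a s ha ih => rw [Finset.sum_insert ha, Finset.prod_insert ha, mon_add, ih]

theorem mon_monMap (A : Fin k → Fin n → ℤ) (w : Fin k → ℤ) :
    mon (monMap A x) w = mon x (∑ i, w i • A i) := by
  rw [mon_sum]
  simp only [mon_zsmul]
  rfl

theorem monMap_pow (A : Fin k → Fin n → ℤ) (N : ℕ) : monMap A (x ^ N) = monMap A x ^ N := by
  funext i
  exact mon_pow x _ N

theorem monMap_one (A : Fin k → Fin n → ℤ) : monMap A (1 : Torus n K) = 1 := by
  funext i
  exact mon_one _

/-- The cocharacter `t ↦ (t^{a 0}, …, t^{a (n-1)})`. -/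
def cochar (a : Fin n → ℤ) (t : Kˣ) : Torus n K := fun i => t ^ a i

theorem mon_cochar (a : Fin n → ℤ) (t : Kˣ) : mon (cochar a t) u = t ^ (∑ i, a i * u i) := by
  simp only [mon, cochar, ← zpow_mul]
  exact (map_sum (zpowersHom Kˣ t).toAdditiveRight (fun i => a i * u i) Finset.univ).symm

end mon

/-! ### Evaluation and substitution -/

section eval

variable {n k : ℕ}

theorem eval_eq_sum (x : Torus n K) (P : Laurent n K) :
    eval x P = ∑ v ∈ P.coeff.support, P.coeff v * (mon x v : K) :=
  eval_apply x P

@[simp] theorem eval_single (x : Torus n K) (u : Fin n → ℤ) (c : K) :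
    eval x (AddMonoidAlgebra.single u c) = c * (mon x u : K) := by
  simp [eval, AddMonoidAlgebra.lift_single, monomialHom, mon]

/-- Substitution of monomials: the comorphism of `monMap A`. -/
noncomputable def pull (A : Fin k → Fin n → ℤ) : Laurent k K →ₐ[K] Laurent n K :=
  AddMonoidAlgebra.mapDomainAlgHom K K
    (Fintype.linearCombination ℤ A : (Fin k → ℤ) →ₗ[ℤ] (Fin n → ℤ)).toAddMonoidHom

theorem pull_single (A : Fin k → Fin n → ℤ) (w : Fin k → ℤ) (c : K) :
    pull A (AddMonoidAlgebra.single w c) = AddMonoidAlgebra.single (∑ i, w i • A i) c := by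
  simp [pull, Fintype.linearCombination_apply]

theorem eval_pull (A : Fin k → Fin n → ℤ) (x : Torus n K) (P : Laurent k K) :
    eval x (pull A P) = eval (monMap A x) P := by
  induction P using AddMonoidAlgebra.induction_linear with
  | zero => simp
  | add P Q hP hQ => simp [hP, hQ]
  | single w c => rw [pull_single, eval_single, eval_single, mon_monMap]

/-- Substitution `x ↦ ζ x`. -/
noncomputable def translate (ζ : Torus n K) (P : Laurent n K) : Laurent n K :=
  ∑ v ∈ P.coeff.support, AddMonoidAlgebra.single v (P.coeff v * (mon ζ v : K))

theorem eval_translate (ζ x : Torus n K) (P : Laurent n K) :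
    eval x (translate ζ P) = eval (ζ * x) P := by
  rw [translate, map_sum, eval_eq_sum]
  refine Finset.sum_congr rfl fun v _ => ?_
  rw [eval_single, mon_mul]
  push_cast
  ring

end eval

/-! ### Zariski topology, vanishing ideals and dimension -/

section topology

variable {n : ℕ}

theorem isClosed_zeroLocus (S : Set (Laurent n K)) :
    IsClosed {x : Torus n K | ∀ P ∈ S, eval x P = 0} :=
  (isClosed_iff _).2 (isAlgebraic_zeroLocus S)

theorem isClosed_zeros (P : Laurent n K) : IsClosed {x : Torus n K | eval x P = 0} := by
  simpa using isClosed_zeroLocus {P}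

theorem continuous_mul_left_torus (ζ : Torus n K) : Continuous fun x : Torus n K => ζ * x := by
  rw [continuous_iff_isClosed]
  intro X hX
  obtain ⟨S, rfl⟩ := (isClosed_iff X).1 hX
  convert isClosed_zeroLocus (translate ζ '' (S : Set (Laurent n K))) using 1
  ext x
  simp [eval_translate]

/-- The ideal of Laurent polynomials that vanish on `X`. -/
def vanIdeal (X : Set (Torus n K)) : Ideal (Laurent n K) where
  carrier := {P | ∀ x ∈ X, eval x P = 0}
  add_mem' hP hQ x hx := by simp [hP x hx, hQ x hx]
  zero_mem' x _ := by simp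
  smul_mem' c P hP x hx := by simp [hP x hx]

theorem mem_vanIdeal {X : Set (Torus n K)} {P : Laurent n K} :
    P ∈ vanIdeal X ↔ ∀ x ∈ X, eval x P = 0 := Iff.rfl

theorem mem_of_vanIdeal {X : Set (Torus n K)} (hX : IsClosed X) {x : Torus n K}
    (h : ∀ P ∈ vanIdeal X, eval x P = 0) : x ∈ X := by
  obtain ⟨S, rfl⟩ := (isClosed_iff X).1 hX
  exact fun P hP => h P fun y hy => hy P hP

theorem vanIdeal_isPrime {X : Set (Torus n K)} (hX : IsIrreducible X) : (vanIdeal X).IsPrime := by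
  refine ⟨fun h => ?_, fun {P Q} h => ?_⟩
  · obtain ⟨x, hx⟩ := hX.1
    have h1 : (1 : Laurent n K) ∈ vanIdeal X := h ▸ Submodule.mem_top
    simpa using h1 x hx
  · have := (isPreirreducible_iff_isClosed_union_isClosed.1 hX.2) _ _ (isClosed_zeros P)
      (isClosed_zeros Q) (fun x hx => by simpa using h x hx)
    exact this

instance noetherianSpace_torus : NoetherianSpace (Torus n K) := by
  have := isNoetherianRing_laurent n K
  refine ((noetherianSpace_TFAE (Torus n K)).out 0 1).2 ?_
  have hanti : StrictAnti fun C : Closeds (Torus n K) => vanIdeal (C : Set (Torus n K)) := by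
    intro C D hCD
    refine lt_of_le_of_ne (fun P hP x hx => hP x (hCD.le hx)) fun h => hCD.not_ge fun x hx => ?_
    exact mem_of_vanIdeal C.isClosed fun P hP => (h.ge hP : P ∈ vanIdeal (D : Set (Torus n K))) x hx
  exact hanti.wellFoundedLT

/-- X itself can be put on top of every chain of irreducible closed subsets of Y; adjoining a top
element raises the Krull dimension by one. -/
theorem dim_add_one_le {X Y : Set (Torus n K)} (hX : IsIrreducible X) (hY : IsClosed Y)
    (hYX : Y ⊂ X) : dim Y + 1 ≤ dim X := by
  unfold dim topologicalKrullDim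
  rcases isEmpty_or_nonempty (IrreducibleCloseds Y) with h | h
  · simp [Order.krullDim_eq_bot]
  rw [← Order.krullDim_WithTop]
  have := Subtype.irreducibleSpace hX
  let ι : Y → X := Set.inclusion hYX.subset
  have hι : Topology.IsInducing ι := (Topology.IsEmbedding.inclusion hYX.subset).isInducing
  let F : WithTop (IrreducibleCloseds Y) → IrreducibleCloseds X
    | ⊤ => ⟨Set.univ, IrreducibleSpace.isIrreducible_univ X, isClosed_univ⟩
    | (Z : IrreducibleCloseds Y) => IrreducibleCloseds.map ι hι.continuous Z
  refine Order.krullDim_le_of_strictMono F ?_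
  have hlt : ∀ Z : IrreducibleCloseds Y, F Z < F ⊤ := by
    intro Z
    refine lt_of_le_of_ne (fun _ _ => trivial) fun h => ?_
    obtain ⟨x, hx, hxY⟩ := Set.exists_of_ssubset hYX
    have hcl : closure (ι '' Z) ⊆ Subtype.val ⁻¹' Y :=
      closure_minimal (by rintro _ ⟨y, _, rfl⟩; exact y.2) (hY.preimage continuous_subtype_val)
    have : (⟨x, hx⟩ : X) ∈ (F Z : Set X) := by rw [h]; trivial
    exact hxY (hcl this)
  intro a b hab
  induction a using WithTop.recTopCoe with
  | top => exact absurd hab not_top_lt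
  | coe a =>
    induction b using WithTop.recTopCoe with
    | top => exact hlt a
    | coe b =>
      exact IrreducibleCloseds.map_strictMono_of_isInducing hι (WithTop.coe_lt_coe.1 hab)

theorem dim_mono {X Y : Set (Torus n K)} (h : Y ⊆ X) : dim Y ≤ dim X :=
  (Topology.IsEmbedding.inclusion h).isInducing.topologicalKrullDim_le

end topology

/-! ### Nullstellensatz on the torus -/

/-- A `K`-algebra homomorphism from Laurent polynomials to `K` is evaluation at a point. -/
theorem exists_eval_eq {n : ℕ} (φ : Laurent n K →ₐ[K] K) : ∃ x : Torus n K, φ = eval x := by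
  let ψ : Multiplicative (Fin n → ℤ) →* Kˣ :=
    ((φ : Laurent n K →* K).comp (AddMonoidAlgebra.of K (Fin n → ℤ))).toHomUnits
  have hψ : ∀ v, φ (AddMonoidAlgebra.single v 1) = ψ (Multiplicative.ofAdd v) := fun v => rfl
  refine ⟨fun i => ψ (Multiplicative.ofAdd (Pi.single i 1)), ?_⟩
  refine AddMonoidAlgebra.algHom_ext (fun v => ?_) (Subsingleton.elim _ _)
  rw [eval_single, one_mul, hψ, Units.val_inj, mon]
  have hv : v = ∑ i, v i • (Pi.single i 1 : Fin n → ℤ) := by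
    funext j
    simp [Finset.sum_apply, Pi.single_apply]
  conv_lhs => rw [hv]
  simp only [ofAdd_sum, map_prod, ofAdd_zsmul, map_zpow]

/-- The Nullstellensatz for primes of the Laurent polynomial ring. -/
theorem exists_point_of_notMem [IsAlgClosed K] {n : ℕ} {p : Ideal (Laurent n K)} (hp : p.IsPrime)
    {f : Laurent n K} (hf : f ∉ p) :
    ∃ x : Torus n K, (∀ P ∈ p, eval x P = 0) ∧ eval x f ≠ 0 := by
  have : IsJacobsonRing (Laurent n K) :=
    isJacobsonRing_of_finiteType (A := K)
  have hj := (isJacobsonRing_iff_prime_eq.1 this p hp)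
  rw [← hj, Ideal.jacobson, Ideal.mem_sInf] at hf
  push Not at hf
  obtain ⟨M, ⟨hpM, hM⟩, hfM⟩ := hf
  let := Ideal.Quotient.field M
  have : Module.Finite K (Laurent n K ⧸ M) := finite_of_finite_type_of_isJacobsonRing _ _
  have hb : Function.Bijective (algebraMap K (Laurent n K ⧸ M)) :=
    IsAlgClosed.algebraMap_bijective_of_isIntegral
  let e : K ≃ₐ[K] (Laurent n K ⧸ M) := AlgEquiv.ofBijective (Algebra.ofId K _) hb
  obtain ⟨x, hx⟩ := exists_eval_eq ((e.symm : (Laurent n K ⧸ M) →ₐ[K] K).comp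
    (Ideal.Quotient.mkₐ K M))
  have key : ∀ P, eval x P = 0 ↔ P ∈ M := by
    intro P
    rw [← hx]
    simp [Ideal.Quotient.eq_zero_iff_mem]
  exact ⟨x, fun P hP => (key P).2 (hpM hP), fun h => hfM ((key f).1 h)⟩

/-! ### Algebraically independent monomials and dimension -/

/-- Algebraic independence on `X` of the monomials with exponents `A i`. -/
def Indep {n m : ℕ} (X : Set (Torus n K)) (A : Fin m → Fin n → ℤ) : Prop :=
  ∀ P : Laurent m K, (∀ x ∈ X, eval (monMap A x) P = 0) → P = 0

section indep

variable {n m : ℕ}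

/-- The inclusion of polynomials into Laurent polynomials. -/
noncomputable def toLaurent (m : ℕ) (K : Type*) [Field K] :
    MvPolynomial (Fin m) K →ₐ[K] Laurent m K :=
  MvPolynomial.aeval fun i => AddMonoidAlgebra.single (Pi.single i 1) 1

theorem toLaurent_monomial (s : Fin m →₀ ℕ) (c : K) :
    toLaurent m K (MvPolynomial.monomial s c) =
      AddMonoidAlgebra.single (fun i => (s i : ℤ)) c := by
  rw [toLaurent, MvPolynomial.aeval_monomial, Finsupp.prod_fintype _ _ (by simp)]
  simp only [AddMonoidAlgebra.single_pow, one_pow]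
  rw [AddMonoidAlgebra.prod_single, AddMonoidAlgebra.coe_algebraMap]
  simp only [Function.comp_apply, AddMonoidAlgebra.single_mul_single, zero_add,
    Finset.prod_const_one, mul_one, Algebra.algebraMap_self, RingHom.id_apply]
  congr 1
  funext j
  simp [Finset.sum_apply, Pi.single_apply]

theorem toLaurent_injective : Function.Injective (toLaurent m K) := by
  rw [injective_iff_map_eq_zero]
  intro P hP
  ext s
  have h := congrArg (fun Q : Laurent m K => Q.coeff fun i => (s i : ℤ)) hP
  have hs : ∀ t : Fin m →₀ ℕ, ((fun i => (t i : ℤ)) = fun i => (s i : ℤ)) ↔ t = s := by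
    intro t
    refine ⟨fun h => ?_, fun h => h ▸ rfl⟩
    ext i
    exact_mod_cast congrFun h i
  rw [P.as_sum, map_sum] at h
  simpa [toLaurent_monomial, AddMonoidAlgebra.coeff_sum, Finsupp.single_apply, hs,
    eq_comm] using h

theorem exists_toLaurent_eq (P : Laurent m K) :
    ∃ (w : Fin m → ℤ) (Q : MvPolynomial (Fin m) K), (∀ i, 0 ≤ w i) ∧
      toLaurent m K Q = AddMonoidAlgebra.single w 1 * P := by
  have hmon : ∀ w : Fin m → ℤ, (∀ i, 0 ≤ w i) → ∀ c : K, toLaurent m K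
      (MvPolynomial.monomial (Finsupp.equivFunOnFinite.symm fun i => (w i).toNat) c) =
        AddMonoidAlgebra.single w c := by
    intro w hw c
    rw [toLaurent_monomial]
    congr 1
    funext i
    simp [hw i]
  induction P using AddMonoidAlgebra.induction_linear with
  | zero => exact ⟨0, 0, by simp, by simp⟩
  | add P Q hP hQ =>
    obtain ⟨w, R, hw, hR⟩ := hP
    obtain ⟨w', R', hw', hR'⟩ := hQ
    refine ⟨w + w', MvPolynomial.monomial
      (Finsupp.equivFunOnFinite.symm fun i => (w' i).toNat) 1 * R + MvPolynomial.monomial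
      (Finsupp.equivFunOnFinite.symm fun i => (w i).toNat) 1 * R',
      fun i => add_nonneg (hw i) (hw' i), ?_⟩
    rw [map_add, map_mul, map_mul, hmon w' hw', hmon w hw, hR, hR', ← mul_assoc, ← mul_assoc,
      AddMonoidAlgebra.single_mul_single, AddMonoidAlgebra.single_mul_single, mul_add, mul_one,
      add_comm w']
  | single v c =>
    refine ⟨fun i => |v i|, _, fun i => abs_nonneg _,
      (hmon (fun i => |v i| + v i) (fun i => ?_) c).trans ?_⟩
    · linarith [neg_abs_le (v i)]
    · rw [AddMonoidAlgebra.single_mul_single, one_mul]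
      rfl

/-- Monomials are units, so a Laurent relation becomes a polynomial one after multiplication by a
monomial. Here φ stands for the map to the coordinate ring of X, or to any ring with the same
kernel. -/
theorem indep_iff_algebraicIndependent {R : Type*} [CommRing R] [Algebra K R]
    {X : Set (Torus n K)} (φ : Laurent n K →ₐ[K] R) (hφ : ∀ P, φ P = 0 ↔ P ∈ vanIdeal X)
    (A : Fin m → Fin n → ℤ) :
    Indep X A ↔ AlgebraicIndependent K fun i => φ (AddMonoidAlgebra.single (A i) 1) := by
  have key : ∀ P : MvPolynomial (Fin m) K,
      MvPolynomial.aeval (fun i => φ (AddMonoidAlgebra.single (A i) 1)) P = 0 ↔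
        ∀ x ∈ X, eval (monMap A x) (toLaurent m K P) = 0 := by
    intro P
    have h1 : MvPolynomial.aeval (fun i => φ (AddMonoidAlgebra.single (A i) 1)) =
        (φ.comp (pull A)).comp (toLaurent m K) := by
      refine MvPolynomial.algHom_ext fun i => ?_
      simp [toLaurent, pull_single, Pi.single_apply]
    rw [h1, AlgHom.comp_apply, AlgHom.comp_apply, hφ, mem_vanIdeal]
    simp only [eval_pull]
  rw [algebraicIndependent_iff]
  constructor
  · intro h P hP
    exact toLaurent_injective ((h _ ((key P).1 hP)).trans (map_zero _).symm)
  · intro h P hP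
    obtain ⟨w, Q, -, hQ⟩ := exists_toLaurent_eq P
    have hQ0 : Q = 0 := by
      refine h Q ((key Q).2 fun x hx => ?_)
      rw [hQ, map_mul, hP x hx, mul_zero]
    rw [hQ0, map_zero] at hQ
    have := congrArg (AddMonoidAlgebra.single (-w) 1 * ·) hQ
    simpa [← mul_assoc, AddMonoidAlgebra.single_mul_single, ← AddMonoidAlgebra.one_def] using this.symm

theorem isIrreducible_of_vanIdeal {X : Set (Torus n K)} (h : (vanIdeal X).IsPrime) :
    IsIrreducible X := by
  refine ⟨?_, isPreirreducible_iff_isClosed_union_isClosed.2 ?_⟩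
  · by_contra hne
    rw [Set.not_nonempty_iff_eq_empty] at hne
    exact h.ne_top ((Ideal.eq_top_iff_one _).2 fun x hx => by simp [hne] at hx)
  · intro Z W hZ hW hXZW
    by_contra! hcon
    obtain ⟨⟨x, hx, hxZ⟩, y, hy, hyW⟩ :=
      And.intro (Set.not_subset.1 hcon.1) (Set.not_subset.1 hcon.2)
    have h1 : ∃ P ∈ vanIdeal Z, eval x P ≠ 0 := by
      by_contra! hc
      exact hxZ (mem_of_vanIdeal hZ hc)
    have h2 : ∃ P ∈ vanIdeal W, eval y P ≠ 0 := by
      by_contra! hc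
      exact hyW (mem_of_vanIdeal hW hc)
    obtain ⟨P, hP, hPx⟩ := h1
    obtain ⟨Q, hQ, hQy⟩ := h2
    have : P * Q ∈ vanIdeal X := by
      intro z hz
      rcases hXZW hz with hz | hz
      · simp [hP z hz]
      · simp [hQ z hz]
    rcases h.mem_or_mem this with h | h
    · exact hPx (h x hx)
    · exact hQy (h y hy)

/-- In the coordinate ring the last monomial is transcendental over the others, so a nonzero prime q
keeps the others independent. Y is its zero locus: the Nullstellensatz recovers the prime from Y,
and q ≠ 0 makes Y proper. -/
theorem exists_ssubset_indep [IsAlgClosed K] {X : Set (Torus n K)} (hX : IsClosed X)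
    (hirr : IsIrreducible X) {A : Fin (m + 1) → Fin n → ℤ} (hA : Indep X A) :
    ∃ Y ⊂ X, IsClosed Y ∧ IsIrreducible Y ∧ Indep Y fun i : Fin m => A i.castSucc := by
  have hprime := vanIdeal_isPrime hirr
  let φ := Ideal.Quotient.mkₐ K (vanIdeal X)
  have hφ : ∀ P, φ P = 0 ↔ P ∈ vanIdeal X := fun P => Ideal.Quotient.eq_zero_iff_mem
  have hA' := (indep_iff_algebraicIndependent φ hφ A).1 hA
  have htr := hA'.transcendental_adjoin (s := Set.range Fin.castSucc) (i := Fin.last m)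
    (by rintro ⟨i, hi⟩; exact (Fin.castSucc_lt_last i).ne hi)
  rw [← Set.range_comp] at htr
  obtain ⟨q, hq, hq0, hqA⟩ := exists_prime_algebraicIndependent
    (hA'.comp _ (Fin.castSucc_injective m)) htr
  let ψ : Laurent n K →ₐ[K] ((Laurent n K ⧸ vanIdeal X) ⧸ q) := (Ideal.Quotient.mkₐ K q).comp φ
  let p : Ideal (Laurent n K) := RingHom.ker ψ
  have hp : p.IsPrime := RingHom.ker_isPrime _
  let Y : Set (Torus n K) := {x | ∀ P ∈ p, eval x P = 0}
  have hYp : vanIdeal Y = p := by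
    refine le_antisymm (fun P hP => ?_) fun P hP x hx => hx P hP
    by_contra hPp
    obtain ⟨x, hx, hxP⟩ := exists_point_of_notMem hp hPp
    exact hxP (hP x hx)
  have hle : vanIdeal X ≤ p := fun P hP => by
    have h0 : φ P = 0 := (hφ P).2 hP
    change ψ P = 0
    simp [ψ, h0]
  refine ⟨Y, ⟨fun x hx => mem_of_vanIdeal hX fun P hP => hx P (hle hP), fun hXY => hq0 ?_⟩,
    isClosed_zeroLocus _, isIrreducible_of_vanIdeal (hYp ▸ hp),
    (indep_iff_algebraicIndependent ψ (fun P => ?_) _).2 hqA⟩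
  · rw [eq_bot_iff]
    intro r hr
    obtain ⟨P, rfl⟩ := Ideal.Quotient.mkₐ_surjective K (vanIdeal X) r
    have hPp : P ∈ p := Ideal.Quotient.eq_zero_iff_mem.2 hr
    exact (hφ P).2 fun x hx => hXY hx P hPp
  · rw [hYp]
    rfl

/-- Each cut by `exists_ssubset_indep` gives up one monomial and at least one dimension. Only this
half of "dimension equals transcendence degree" is needed. -/
theorem le_dim_of_indep [IsAlgClosed K] {X : Set (Torus n K)} (hX : IsClosed X)
    (hirr : IsIrreducible X) {A : Fin m → Fin n → ℤ} (hA : Indep X A) :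
    (m : WithBot ℕ∞) ≤ dim X := by
  induction m generalizing X with
  | zero =>
    have := Subtype.irreducibleSpace hirr
    have : Nonempty (IrreducibleCloseds X) :=
      ⟨⟨Set.univ, IrreducibleSpace.isIrreducible_univ X, isClosed_univ⟩⟩
    exact Order.krullDim_nonneg
  | succ m ih =>
    obtain ⟨Y, hYX, hY, hYi, hYA⟩ := exists_ssubset_indep hX hirr hA
    have h1 := ih hY hYi hYA
    have h2 := dim_add_one_le hirr hY hYX
    push_cast
    exact (add_le_add_left h1 1).trans h2

end indep

/-! ### Elementary counting: fibres, roots, roots of unity -/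

theorem finite_ncard_le_of_fibers {α β : Type*} {S : Set α} {T : Set β} (hT : T.Finite)
    (f : α → β) (hf : Set.MapsTo f S T) (c : ℕ)
    (h : ∀ b ∈ T, {x ∈ S | f x = b}.Finite ∧ {x ∈ S | f x = b}.ncard ≤ c) :
    S.Finite ∧ S.ncard ≤ c * T.ncard := by
  classical
  have hS : S.Finite := by
    refine (hT.biUnion fun b hb => (h b hb).1).subset fun x hx => ?_
    exact Set.mem_biUnion (hf hx) ⟨hx, rfl⟩
  refine ⟨hS, ?_⟩
  lift S to Finset α using hS
  lift T to Finset β using hT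
  rw [Set.ncard_coe_finset, Set.ncard_coe_finset]
  refine Finset.card_le_mul_card_image_of_maps_to hf c fun b hb => ?_
  have := (h b hb).2
  rwa [← Set.ncard_coe_finset, Finset.coe_filter]

/-- A nonzero Laurent polynomial in one variable, with exponents in `[-M, M]`, has at most `2M`
roots. -/
theorem root_count {ι : Type*} (s : Finset ι) (c : ι → K) (e : ι → ℤ) (M : ℕ)
    (hM : ∀ i ∈ s, |e i| ≤ M) (ε : ℤ) (hε : ∑ i ∈ s with e i = ε, c i ≠ 0) :
    {t : Kˣ | ∑ i ∈ s, c i * ((t ^ e i : Kˣ) : K) = 0}.Finite ∧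
      {t : Kˣ | ∑ i ∈ s, c i * ((t ^ e i : Kˣ) : K) = 0}.ncard ≤ 2 * M := by
  classical
  -- Multiplication by t^M gives an honest polynomial of degree at most 2M. Several i may share an
  -- exponent, so nonvanishing is read off from the whole coefficient of t^ε.
  let p : Polynomial K := ∑ i ∈ s, Polynomial.C (c i) * Polynomial.X ^ (e i + M).toNat
  have hnn : ∀ i ∈ s, 0 ≤ e i + M := fun i hi => by linarith [neg_abs_le (e i), hM i hi]
  have hεM : 0 ≤ ε + M := by
    obtain ⟨i, hi, -⟩ := Finset.exists_ne_zero_of_sum_ne_zero hε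
    rw [Finset.mem_filter] at hi
    exact hi.2 ▸ hnn i hi.1
  have hp : p ≠ 0 := by
    intro h0
    apply hε
    have h1 := congrArg (fun q => Polynomial.coeff q (ε + M).toNat) h0
    simp only [p, Polynomial.finsetSum_coeff, Polynomial.coeff_C_mul_X_pow,
      Polynomial.coeff_zero] at h1
    rw [← h1, Finset.sum_filter]
    refine Finset.sum_congr rfl fun i hi => ?_
    have := hnn i hi
    refine if_congr ?_ rfl rfl
    omega
  have hdeg : p.natDegree ≤ 2 * M := by
    refine Polynomial.natDegree_sum_le_of_forall_le _ _ fun i hi => ?_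
    refine (Polynomial.natDegree_C_mul_X_pow_le _ _).trans ?_
    have := hnn i hi
    have := le_abs_self (e i)
    have := hM i hi
    omega
  have heval : ∀ t : Kˣ, p.eval (t : K) =
      (t : K) ^ M * ∑ i ∈ s, c i * ((t ^ e i : Kˣ) : K) := by
    intro t
    simp only [p, Polynomial.eval_finsetSum, Polynomial.eval_mul, Polynomial.eval_C,
      Polynomial.eval_pow, Polynomial.eval_X, Finset.mul_sum]
    refine Finset.sum_congr rfl fun i hi => ?_
    have h1 : t ^ (e i + M).toNat = t ^ M * t ^ e i := by
      rw [← zpow_natCast, Int.toNat_of_nonneg (hnn i hi), zpow_add, zpow_natCast, mul_comm]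
    rw [← Units.val_pow_eq_pow_val, h1]
    push_cast
    ring
  have hsub : Units.val '' {t : Kˣ | ∑ i ∈ s, c i * ((t ^ e i : Kˣ) : K) = 0} ⊆
      (p.roots.toFinset : Set K) := by
    rintro _ ⟨t, ht, rfl⟩
    rw [Finset.mem_coe, Multiset.mem_toFinset, Polynomial.mem_roots hp, Polynomial.IsRoot, heval]
    exact mul_eq_zero_of_right _ ht
  have hfin := (Finset.finite_toSet _).subset hsub
  refine ⟨hfin.of_finite_image Units.val_injective.injOn, ?_⟩
  rw [← Set.ncard_image_of_injective _ Units.val_injective]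
  refine (Set.ncard_le_ncard hsub (Finset.finite_toSet _)).trans ?_
  rw [Set.ncard_coe_finset]
  exact ((Multiset.toFinset_card_le _).trans (Polynomial.card_roots' p)).trans hdeg

theorem finite_roots_of_unity {N : ℕ} (hN : 0 < N) :
    {t : Kˣ | t ^ N = 1}.Finite ∧ {t : Kˣ | t ^ N = 1}.ncard ≤ N := by
  have : NeZero N := ⟨hN.ne'⟩
  have hset : {t : Kˣ | t ^ N = 1} = (rootsOfUnity N K : Set Kˣ) := by
    ext t
    simp
  rw [hset]
  have : Finite (rootsOfUnity N K) := inferInstance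
  refine ⟨this, ?_⟩
  rw [← Nat.card_coe_set_eq]
  exact card_rootsOfUnity K N

/-- The first p coordinates are prescribed and each other one has at most N values. -/
theorem finite_ncard_torsion_le {m p : ℕ} (hpm : p ≤ m) (y : Torus p K) {N : ℕ} (hN : 0 < N) :
    {z : Torus m K | z ^ N = 1 ∧ ∀ i, z (Fin.castLE hpm i) = y i}.Finite ∧
      {z : Torus m K | z ^ N = 1 ∧ ∀ i, z (Fin.castLE hpm i) = y i}.ncard ≤ N ^ (m - p) := by
  classical
  obtain ⟨hf, hc⟩ := finite_roots_of_unity (K := K) hN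
  let F : Fin m → Finset Kˣ := fun i => if h : (i : ℕ) < p then {y ⟨i, h⟩} else hf.toFinset
  have hsub : {z : Torus m K | z ^ N = 1 ∧ ∀ i, z (Fin.castLE hpm i) = y i} ⊆
      (Fintype.piFinset F : Set (Torus m K)) := by
    rintro z ⟨hz, hzy⟩
    rw [Finset.mem_coe, Fintype.mem_piFinset]
    intro i
    by_cases h : (i : ℕ) < p
    · simp only [F, h, dif_pos, Finset.mem_singleton]
      exact hzy ⟨i, h⟩
    · simp only [F, h, dif_neg, not_false_eq_true, Set.Finite.mem_toFinset, Set.mem_ofPred_eq]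
      exact congrFun hz i
  refine ⟨(Finset.finite_toSet _).subset hsub,
    (Set.ncard_le_ncard hsub (Finset.finite_toSet _)).trans ?_⟩
  rw [Set.ncard_coe_finset, Fintype.card_piFinset]
  have hle : ∀ i ∈ Finset.univ, (F i).card ≤ if (i : ℕ) < p then 1 else N := by
    intro i _
    by_cases h : (i : ℕ) < p
    · simp [F, h]
    · simp only [F, h, dif_neg, not_false_eq_true, if_false]
      rwa [← Set.ncard_eq_toFinset_card _ hf]
  refine (Finset.prod_le_prod' hle).trans ?_
  rw [Finset.prod_ite]
  simp only [Finset.prod_const_one, one_mul, Finset.prod_const]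
  refine Nat.pow_le_pow_right hN ?_
  have h1 := Finset.card_filter_add_card_filter_not (s := (Finset.univ : Finset (Fin m)))
    (fun i => (i : ℕ) < p)
  have h2 : p ≤ (Finset.univ.filter fun i : Fin m => (i : ℕ) < p).card := by
    calc p = (Finset.univ.map (Fin.castLEEmb hpm)).card := by simp
      _ ≤ _ := Finset.card_le_card fun i hi => by
        simp only [Finset.mem_map, Finset.mem_univ, true_and] at hi
        obtain ⟨j, rfl⟩ := hi
        simp
  simp only [Finset.card_univ, Fintype.card_fin] at h1
  omega

/-! ### Fibres of monomial maps and the trivial torsion bound -/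

section fibers

variable {n m : ℕ}

theorem monMap_snoc (B : Fin m → Fin n → ℤ) (u : Fin n → ℤ) (x : Torus n K) :
    monMap (Fin.snoc B u : Fin (m + 1) → Fin n → ℤ) x =
      (Fin.snoc (monMap B x) (mon x u) : Fin (m + 1) → Kˣ) := by
  funext i
  refine Fin.lastCases ?_ (fun i => ?_) i <;> simp [monMap]

theorem mon_snoc (z : Torus m K) (t : Kˣ) (v : Fin (m + 1) → ℤ) :
    mon (Fin.snoc z t : Fin (m + 1) → Kˣ) v = mon z (Fin.init v) * t ^ v (Fin.last m) := by
  simp [mon, Fin.prod_univ_castSucc, Fin.init]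

/-- View a relation as a Laurent polynomial in the last monomial; P is one nonzero coefficient.
Where P does not vanish, the last monomial is a root of a nonzero polynomial whose degree does not
depend on z. -/
theorem exists_bound_of_not_indep_snoc {X : Set (Torus n K)} {B : Fin m → Fin n → ℤ}
    {u : Fin n → ℤ} (h : ¬ Indep X (Fin.snoc B u : Fin (m + 1) → Fin n → ℤ)) :
    ∃ P : Laurent m K, P ≠ 0 ∧ ∃ M : ℕ, ∀ z : Torus m K, eval z P ≠ 0 →
      ∃ R : Finset Kˣ, R.card ≤ M ∧ ∀ x ∈ X, monMap B x = z → mon x u ∈ R := by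
  classical
  simp only [Indep, not_forall] at h
  obtain ⟨f, hf, hf0⟩ := h
  have hf0' : f.coeff ≠ 0 := by simpa using hf0
  obtain ⟨v₀, hv₀⟩ := Finsupp.support_nonempty_iff.2 hf0'
  set s := f.coeff.support.filter fun v => v (Fin.last m) = v₀ (Fin.last m) with hs
  let P : Laurent m K := ∑ v ∈ s, AddMonoidAlgebra.single (Fin.init v) (f.coeff v)
  have hP : P.coeff (Fin.init v₀) = f.coeff v₀ := by
    simp only [P, AddMonoidAlgebra.coeff_sum, AddMonoidAlgebra.coeff_single, Finsupp.finsetSum_apply,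
      Finsupp.single_apply]
    rw [Finset.sum_eq_single v₀]
    · simp
    · intro v hv hne
      refine if_neg fun hvv => hne ?_
      rw [hs, Finset.mem_filter] at hv
      rw [← Fin.snoc_init_self v, ← Fin.snoc_init_self v₀, hvv, hv.2]
    · intro h
      exact absurd (hs ▸ Finset.mem_filter.2 ⟨hv₀, rfl⟩) h
  obtain ⟨M, hM⟩ : ∃ M : ℕ, ∀ v ∈ f.coeff.support, |v (Fin.last m)| ≤ M := by
    refine ⟨f.coeff.support.sup fun v => (v (Fin.last m)).natAbs, fun v hv => ?_⟩
    rw [Int.abs_eq_natAbs]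
    exact_mod_cast Finset.le_sup (f := fun v : Fin (m + 1) → ℤ => (v (Fin.last m)).natAbs) hv
  refine ⟨P, fun h => ?_, 2 * M, fun z hz => ?_⟩
  · rw [h] at hP
    exact Finsupp.mem_support_iff.1 hv₀ (by simpa using hP.symm)
  · have hrc := root_count f.coeff.support (fun v => f.coeff v * (mon z (Fin.init v) : K))
      (fun v => v (Fin.last m)) M hM (v₀ (Fin.last m)) (by
        simpa [P, map_sum] using hz)
    refine ⟨hrc.1.toFinset, (Set.ncard_eq_toFinset_card _ hrc.1) ▸ hrc.2, fun x hx hxz => ?_⟩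
    simp only [Set.Finite.mem_toFinset, Set.mem_ofPred_eq]
    rw [← hf x hx, eval_eq_sum]
    refine Finset.sum_congr rfl fun v _ => ?_
    rw [monMap_snoc, mon_snoc, hxz]
    push_cast
    ring

/-- Outside a proper closed subset, the fibres of a maximal independent system of monomials are
bounded. -/
theorem exists_fiber_bound {X : Set (Torus n K)} (hX : IsClosed X) (hirr : IsIrreducible X)
    {B : Fin m → Fin n → ℤ} (hB : Indep X B)
    (hmax : ∀ u, ¬ Indep X (Fin.snoc B u : Fin (m + 1) → Fin n → ℤ)) :
    ∃ (C : ℕ) (Y : Set (Torus n K)), IsClosed Y ∧ Y ⊂ X ∧ ∀ z : Torus m K,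
      {x | (x ∈ X ∧ x ∉ Y) ∧ monMap B x = z}.Finite ∧
        {x | (x ∈ X ∧ x ∉ Y) ∧ monMap B x = z}.ncard ≤ C := by
  classical
  -- Maximality makes each coordinate function algebraic over the monomials B; off the zeros of all
  -- leading coefficients, coordinate j takes at most M j values on a fibre.
  choose P hP0 M hM using fun j : Fin n => exists_bound_of_not_indep_snoc (hmax (Pi.single j 1))
  let Q : Laurent n K := pull B (∏ j, P j)
  have hQ : Q ∉ vanIdeal X := by
    have hp := vanIdeal_isPrime hirr
    intro h
    simp only [Q, map_prod, Ideal.IsPrime.prod_mem_iff] at h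
    obtain ⟨j, -, hj⟩ := h
    exact hP0 j (hB _ fun x hx => by rw [← eval_pull]; exact hj x hx)
  refine ⟨∏ j, M j, X ∩ {x | eval x Q = 0}, hX.inter (isClosed_zeros Q),
    ⟨Set.inter_subset_left, fun h => hQ fun x hx => (h hx).2⟩, fun z => ?_⟩
  by_cases hz : ∀ j, eval z (P j) ≠ 0
  · choose R hR hRx using fun j => hM j z (hz j)
    have hsub : {x | (x ∈ X ∧ x ∉ X ∩ {x | eval x Q = 0}) ∧ monMap B x = z} ⊆
        (Fintype.piFinset R : Set (Torus n K)) := by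
      rintro x ⟨⟨hx, -⟩, hxz⟩
      rw [Finset.mem_coe, Fintype.mem_piFinset]
      intro j
      simpa [mon_single] using hRx j x hx hxz
    refine ⟨(Finset.finite_toSet _).subset hsub,
      (Set.ncard_le_ncard hsub (Finset.finite_toSet _)).trans ?_⟩
    rw [Set.ncard_coe_finset, Fintype.card_piFinset]
    exact Finset.prod_le_prod' fun j _ => hR j
  · have hempty : {x | (x ∈ X ∧ x ∉ X ∩ {x | eval x Q = 0}) ∧ monMap B x = z} = ∅ := by
      rw [Set.eq_empty_iff_forall_notMem]
      rintro x ⟨⟨hx, hxY⟩, rfl⟩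
      refine hxY ⟨hx, ?_⟩
      push Not at hz
      obtain ⟨j, hj⟩ := hz
      simp only [Set.mem_ofPred_eq, Q, eval_pull, map_prod]
      exact Finset.prod_eq_zero (Finset.mem_univ j) hj
    rw [hempty]
    simp

/-- Greedy extension stops, because `le_dim_of_indep` bounds the length by d. -/
theorem exists_maximal_indep [IsAlgClosed K] {X : Set (Torus n K)} (hX : IsClosed X)
    (hirr : IsIrreducible X) {d : ℕ} (hd : dim X ≤ d) {p : ℕ} (A : Fin p → Fin n → ℤ)
    (hA : Indep X A) :
    ∃ (m : ℕ) (h : p ≤ m) (D : Fin m → Fin n → ℤ), m ≤ d ∧ (∀ i, D (Fin.castLE h i) = A i) ∧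
      Indep X D ∧ ∀ u, ¬ Indep X (Fin.snoc D u : Fin (m + 1) → Fin n → ℤ) := by
  induction hk : d - p generalizing p with
  | zero =>
    have hpd : p ≤ d := by exact_mod_cast (le_dim_of_indep hX hirr hA).trans hd
    refine ⟨p, le_rfl, A, hpd, fun i => rfl, hA, fun u hu => ?_⟩
    have : p + 1 ≤ d := by exact_mod_cast (le_dim_of_indep hX hirr hu).trans hd
    omega
  | succ k ih =>
    by_cases hu : ∃ u, Indep X (Fin.snoc A u : Fin (p + 1) → Fin n → ℤ)
    · obtain ⟨u, hu⟩ := hu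
      obtain ⟨m, h, D, hmd, hDA, hD, hDm⟩ := ih _ hu (by omega)
      refine ⟨m, (Nat.le_succ p).trans h, D, hmd, fun i => ?_, hD, hDm⟩
      have := hDA i.castSucc
      rw [Fin.snoc_castSucc] at this
      exact this
    · push Not at hu
      have hpd : p ≤ d := by exact_mod_cast (le_dim_of_indep hX hirr hA).trans hd
      exact ⟨p, le_rfl, A, hpd, fun i => rfl, hA, hu⟩

theorem indep_zero {X : Set (Torus n K)} (hX : X.Nonempty) (A : Fin 0 → Fin n → ℤ) :
    Indep X A := by
  intro P hP
  obtain ⟨x, hx⟩ := hX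
  have hPs : P = AddMonoidAlgebra.single 0 (P.coeff 0) := by
    refine AddMonoidAlgebra.coeff_injective (Finsupp.ext fun v => ?_)
    rw [Subsingleton.elim v 0]
    simp
  have := hP x hx
  rw [hPs, eval_single] at this
  rw [hPs]
  simpa using this

/-- The trivial bound for the number of torsion points on an algebraic set of dimension less
than `e`. -/
theorem exists_torsion_bound [IsAlgClosed K] (e : ℕ) (X : Set (Torus n K)) (hX : IsClosed X)
    (hd : dim X < e) : ∃ c : ℕ, ∀ N : ℕ, 0 < N → {x ∈ X | x ^ N = 1}.Finite ∧
      N * {x ∈ X | x ^ N = 1}.ncard ≤ c * N ^ e := by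
  classical
  -- The factor N on the left avoids the exponent e - 1; for e = 0 the set is empty.
  induction e generalizing X with
  | zero =>
    have hXe : X = ∅ := by
      by_contra hne
      rw [← Ne, ← Set.nonempty_iff_ne_empty] at hne
      obtain ⟨x, hx⟩ := hne
      have : Nonempty (IrreducibleCloseds X) :=
        ⟨⟨closure {⟨x, hx⟩}, isIrreducible_singleton.closure, isClosed_closure⟩⟩
      exact absurd (Order.krullDim_nonneg (α := IrreducibleCloseds X)) (not_le.2 hd)
    subst hXe
    exact ⟨0, fun N _ => by simp⟩
  | succ e ih =>
    have hirr : ∀ Z : Set (Torus n K), IsClosed Z → IsIrreducible Z → Z ⊆ X →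
        ∃ c : ℕ, ∀ N : ℕ, 0 < N → {x ∈ Z | x ^ N = 1}.Finite ∧
          N * {x ∈ Z | x ^ N = 1}.ncard ≤ c * N ^ (e + 1) := by
      intro Z hZ hZi hZX
      have hZd : dim Z < (e + 1 : ℕ) := (dim_mono hZX).trans_lt hd
      -- Generic N-torsion maps with bounded fibres into the at most N^m torsion points of an
      -- m-dimensional torus, m ≤ e; the rest lies on Y, of smaller dimension.
      obtain ⟨m, -, D, hme, -, hD, hDm⟩ := exists_maximal_indep hZ hZi hZd.le
        (Fin.elim0 : Fin 0 → Fin n → ℤ) (indep_zero hZi.1 _)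
      replace hme : m ≤ e := by
        have : (m : WithBot ℕ∞) < (e + 1 : ℕ) := (le_dim_of_indep hZ hZi hD).trans_lt hZd
        have : m < e + 1 := by exact_mod_cast this
        omega
      obtain ⟨C, Y, hY, hYZ, hC⟩ := exists_fiber_bound hZ hZi hD hDm
      have hYd : dim Y < e := by
        by_contra! hcon
        have h1 := dim_add_one_le hZi hY hYZ
        have h2 : ((e + 1 : ℕ) : WithBot ℕ∞) ≤ dim Y + 1 := by
          push_cast
          exact add_le_add_left hcon 1
        exact absurd (h2.trans h1) (not_le.2 hZd)
      obtain ⟨c, hc⟩ := ih Y hY hYd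
      refine ⟨C + c, fun N hN => ?_⟩
      obtain ⟨hcf, hcN⟩ := hc N hN
      have hT := finite_ncard_torsion_le (Nat.zero_le m) (1 : Torus 0 K) hN
      have hfib := finite_ncard_le_of_fibers (S := {x | (x ∈ Z ∧ x ∉ Y) ∧ x ^ N = 1}) hT.1
        (monMap D) (by
          rintro x ⟨-, hx⟩
          exact ⟨by rw [← monMap_pow, hx, monMap_one], fun i => i.elim0⟩) C (fun z _ => by
          have hsub : {x ∈ {x | (x ∈ Z ∧ x ∉ Y) ∧ x ^ N = 1} | monMap D x = z} ⊆
            {x | (x ∈ Z ∧ x ∉ Y) ∧ monMap D x = z} := fun x hx => ⟨hx.1.1, hx.2⟩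
          exact ⟨(hC z).1.subset hsub, (Set.ncard_le_ncard hsub (hC z).1).trans (hC z).2⟩)
      have hunion : {x ∈ Z | x ^ N = 1} ⊆
          {x | (x ∈ Z ∧ x ∉ Y) ∧ x ^ N = 1} ∪ {x ∈ Y | x ^ N = 1} := by
        rintro x ⟨hx, hxN⟩
        by_cases hxY : x ∈ Y
        · exact Or.inr ⟨hxY, hxN⟩
        · exact Or.inl ⟨⟨hx, hxY⟩, hxN⟩
      have hfin := hfib.1.union hcf
      refine ⟨hfin.subset hunion, ?_⟩
      have h1 : {x | (x ∈ Z ∧ x ∉ Y) ∧ x ^ N = 1}.ncard ≤ C * N ^ e :=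
        hfib.2.trans (Nat.mul_le_mul_left _ (hT.2.trans (Nat.pow_le_pow_right hN (by omega))))
      calc N * {x ∈ Z | x ^ N = 1}.ncard
          ≤ N * ({x | (x ∈ Z ∧ x ∉ Y) ∧ x ^ N = 1}.ncard + {x ∈ Y | x ^ N = 1}.ncard) :=
            Nat.mul_le_mul_left _ ((Set.ncard_le_ncard hunion hfin).trans (Set.ncard_union_le _ _))
        _ ≤ N * (C * N ^ e) + c * N ^ e := by
            rw [mul_add]
            exact Nat.add_le_add (Nat.mul_le_mul_left _ h1) hcN
        _ ≤ N * (C * N ^ e) + N * (c * N ^ e) :=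
            Nat.add_le_add_left (Nat.le_mul_of_pos_left _ hN) _
        _ = (C + c) * N ^ (e + 1) := by ring
    obtain ⟨S, hSf, hSc, hSi, rfl⟩ := NoetherianSpace.exists_finite_set_isClosed_irreducible hX
    lift S to Finset (Set (Torus n K)) using hSf
    have : ∀ Z : S, ∃ c : ℕ, ∀ N : ℕ, 0 < N → {x ∈ (Z : Set (Torus n K)) | x ^ N = 1}.Finite ∧
        N * {x ∈ (Z : Set (Torus n K)) | x ^ N = 1}.ncard ≤ c * N ^ (e + 1) := fun Z =>
      hirr Z (hSc Z Z.2) (hSi Z Z.2) (Set.subset_sUnion_of_mem Z.2)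
    choose c hc using this
    refine ⟨∑ Z, c Z, fun N hN => ?_⟩
    have heq : {x ∈ ⋃₀ (S : Set (Set (Torus n K))) | x ^ N = 1} =
        ⋃ Z ∈ (Finset.univ : Finset S), {x ∈ (Z : Set (Torus n K)) | x ^ N = 1} := by
      ext x
      simp
    rw [heq]
    refine ⟨Set.Finite.biUnion (Finset.finite_toSet _) fun Z _ => (hc Z N hN).1, ?_⟩
    refine (Nat.mul_le_mul_left _ (Finset.set_ncard_biUnion_le _ _)).trans ?_
    rw [Finset.mul_sum, Finset.sum_mul]
    exact Finset.sum_le_sum fun Z _ => (hc Z N hN).2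

end fibers

/-! ### Torsion points on cosets of one-parameter subgroups -/

section lattice

variable {k : ℕ}

/-- A finite group of roots of unity in a field is cyclic. Its generator has order exactly `orderOf
η`, because its order also kills η. -/
theorem exists_generator {η : Torus k K} (hη : 0 < orderOf η) :
    ∃ ω : Kˣ, orderOf ω = orderOf η ∧ ∃ b : Fin k → ℤ, ∀ i, η i = ω ^ b i := by
  have : NeZero (orderOf η) := ⟨hη.ne'⟩
  obtain ⟨w, hw⟩ := IsCyclic.exists_zpow_surjective (G := rootsOfUnity (orderOf η) K)
  have hmem : ∀ i, η i ∈ rootsOfUnity (orderOf η) K := fun i =>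
    (mem_rootsOfUnity _ _).2 (congrFun (pow_orderOf_eq_one η) i)
  choose b hb using fun i => hw ⟨η i, hmem i⟩
  have hb' : ∀ i, η i = (w : Kˣ) ^ b i := fun i => by
    have := congrArg Subtype.val (hb i)
    simpa using this.symm
  refine ⟨w, Nat.dvd_antisymm (orderOf_dvd_of_pow_eq_one ((mem_rootsOfUnity _ _).1 w.2)) ?_, b, hb'⟩
  refine orderOf_dvd_of_pow_eq_one (funext fun i => ?_)
  rw [Pi.pow_apply, hb', ← zpow_natCast, ← zpow_mul, mul_comm, zpow_mul, zpow_natCast,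
    pow_orderOf_eq_one, one_zpow, Pi.one_apply]

/-- Simultaneous approximation by the pigeonhole principle. -/
theorem exists_small_multiple {N q : ℕ} (hN : 0 < N) (hqpos : 0 < q) (hq : q ^ k < N) (b : Fin k → ℤ) :
    ∃ (j : ℤ) (a : Fin k → ℤ), 0 < j ∧ j < N ∧ (∀ i, (N : ℤ) ∣ a i - j * b i) ∧
      ∀ i, q * |a i| < N := by
  have hN' : (0 : ℤ) < N := by exact_mod_cast hN
  have hr0 : ∀ x : ℤ, 0 ≤ x % N := fun x => Int.emod_nonneg _ hN'.ne'
  have hrN : ∀ x : ℤ, x % N < N := fun x => Int.emod_lt_of_pos _ hN'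
  have hdiv0 : ∀ (j : ℕ) (i : Fin k), 0 ≤ (q * ((j * b i) % N)) / (N : ℤ) := fun j i =>
    Int.ediv_nonneg (mul_nonneg (by positivity) (hr0 _)) hN'.le
  -- The fractional parts of j·b_i/N are sorted into q^k < N boxes; two of the N values of j share a
  -- box, and their difference is the required multiplier.
  let F : ℕ → Fin k → ℕ := fun j i => ((q * ((j * b i) % N)) / (N : ℤ)).toNat
  have hmaps : Set.MapsTo F (Finset.range N) (Fintype.piFinset fun _ : Fin k => Finset.range q) := by
    intro j _
    rw [Finset.mem_coe, Fintype.mem_piFinset]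
    intro i
    rw [Finset.mem_range]
    have h1 : (q * ((j * b i) % N)) / (N : ℤ) < q := by
      refine Int.ediv_lt_of_lt_mul hN' ?_
      exact mul_lt_mul_of_pos_left (hrN _) (by exact_mod_cast hqpos)
    have h2 := hdiv0 j i
    simp only [F]
    omega
  have hcard : (Fintype.piFinset fun _ : Fin k => Finset.range q).card < (Finset.range N).card := by
    simpa using hq
  obtain ⟨j₁, hj₁, j₂, hj₂, hne, hF⟩ := Finset.exists_ne_map_eq_of_card_lt_of_maps_to hcard hmaps
  wlog hlt : j₁ < j₂ generalizing j₁ j₂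
  · exact this j₂ hj₂ j₁ hj₁ hne.symm hF.symm (by omega)
  rw [Finset.mem_range] at hj₁ hj₂
  refine ⟨(j₂ : ℤ) - j₁, fun i => (j₂ * b i) % N - (j₁ * b i) % N, by omega, by omega,
    fun i => ?_, fun i => ?_⟩
  · have h1 := Int.mul_ediv_add_emod (j₁ * b i) N
    have h2 := Int.mul_ediv_add_emod (j₂ * b i) N
    exact ⟨(j₁ * b i) / N - (j₂ * b i) / N, by linear_combination h2 - h1⟩
  · have hFi : (q * ((j₁ * b i) % N)) / (N : ℤ) = (q * ((j₂ * b i) % N)) / (N : ℤ) := by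
      have h1 := congrFun hF i
      have h2 := hdiv0 j₁ i
      have h3 := hdiv0 j₂ i
      simp only [F] at h1
      omega
    have h1 := Int.mul_ediv_add_emod (q * ((j₁ * b i) % N)) N
    have h2 := Int.mul_ediv_add_emod (q * ((j₂ * b i) % N)) N
    have h3 := hr0 (q * ((j₁ * b i) % N))
    have h4 := hr0 (q * ((j₂ * b i) % N))
    have h5 := hrN (q * ((j₁ * b i) % N))
    have h6 := hrN (q * ((j₂ * b i) % N))
    have habs : (q : ℤ) * |(j₂ * b i) % N - (j₁ * b i) % N| =
        |q * ((j₂ * b i) % N) - q * ((j₁ * b i) % N)| := by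
      rw [← mul_sub, abs_mul, Nat.abs_cast]
    rw [habs, abs_lt]
    rw [hFi] at h1
    constructor <;> linarith

theorem exists_pow_lt_le {N k : ℕ} (hN : 2 ≤ N) (hk : k ≠ 0) :
    ∃ q : ℕ, 0 < q ∧ q ^ k < N ∧ N ≤ (q + 1) ^ k := by
  classical
  have hex : ∃ Q : ℕ, N ≤ Q ^ k := ⟨N, Nat.le_self_pow hk N⟩
  have h2 : 2 ≤ Nat.find hex := by
    rw [Nat.le_find_iff]
    intro m hm
    interval_cases m
    · rw [zero_pow hk]; omega
    · rw [one_pow]; omega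
  refine ⟨Nat.find hex - 1, by omega, not_le.1 (Nat.find_min hex (by omega)), ?_⟩
  rw [Nat.sub_add_cancel (by omega)]
  exact Nat.find_spec hex

theorem cochar_pow (a : Fin k → ℤ) (t : Kˣ) (g : ℕ) : cochar a t ^ g = cochar a (t ^ g) := by
  funext i
  simp only [cochar, Pi.pow_apply]
  rw [← zpow_natCast, ← zpow_mul, mul_comm, zpow_mul, zpow_natCast]

/-- A torsion point of order `N` lies on a translate, by a point of order dividing `g`, of a
one-parameter subgroup whose exponents are at most `2 N ^ (1 - 1 / k) / g`. -/
theorem exists_cochar (hk : k ≠ 0) {η : Torus k K} (hη : 0 < orderOf η) :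
    ∃ (g : ℕ) (a : Fin k → ℤ), 0 < g ∧ (∃ v : Fin k → ℤ, ∑ i, a i * v i = 1) ∧
      (∀ i, (g : ℝ) * |(a i : ℝ)| ≤ 2 * (orderOf η : ℝ) ^ (1 - 1 / (k : ℝ))) ∧
      ∀ v : Fin k → ℤ, ∑ i, a i * v i = 1 → (η * (cochar a (mon η v))⁻¹) ^ g = 1 := by
  set N := orderOf η with hNdef
  have hk' : (k : ℝ) ≠ 0 := by exact_mod_cast hk
  -- For N = 1 there is no q > 0 with q^k < N, so the identity is treated separately.
  rcases Nat.lt_or_ge N 2 with hN1 | hN2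
  · have hN1 : N = 1 := by omega
    have hη1 : η = 1 := orderOf_eq_one_iff.1 (hNdef ▸ hN1)
    let i₀ : Fin k := ⟨0, Nat.pos_of_ne_zero hk⟩
    refine ⟨1, Pi.single i₀ 1, one_pos, ⟨Pi.single i₀ 1, ?_⟩, fun i => ?_, fun v _ => ?_⟩
    · simp [Pi.single_apply]
    · rw [hN1]
      by_cases hi : i = i₀
      · subst hi; simp
      · simp [Pi.single_eq_of_ne hi]
    · rw [hη1, mon_one]
      funext i
      simp [cochar]
  obtain ⟨ω, hω, b, hb⟩ := exists_generator hη
  obtain ⟨q, hq0, hqN, hNq⟩ := exists_pow_lt_le hN2 hk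
  obtain ⟨j, a, hj0, hjN, hdvd, hsmall⟩ := exists_small_multiple hη hq0 hqN b
  have hωN : ω ^ (N : ℤ) = 1 := by rw [zpow_natCast, hNdef, ← hω, pow_orderOf_eq_one]
  have hpow : ∀ i, ω ^ a i = η i ^ j := by
    intro i
    obtain ⟨c, hc⟩ := hdvd i
    have : a i = b i * j + N * c := by linear_combination hc
    rw [this, zpow_add, zpow_mul, zpow_mul, hωN, one_zpow, mul_one, hb]
  -- If a = 0 then η^j = 1, against 0 < j < N.
  have ha0 : ∃ i, a i ≠ 0 := by
    by_contra! hcon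
    have h1 : η ^ j.toNat = 1 := by
      funext i
      rw [Pi.pow_apply, ← zpow_natCast, Int.toNat_of_nonneg hj0.le, ← hpow, hcon, zpow_zero,
        Pi.one_apply]
    have h2 := Nat.le_of_dvd (by omega) (orderOf_dvd_of_pow_eq_one h1)
    omega
  let I : Ideal ℤ := Ideal.span (Set.range a)
  obtain ⟨h, hI⟩ := (IsPrincipalIdealRing.principal I).principal
  obtain ⟨v₀, hv₀⟩ : ∃ v : Fin k → ℤ, ∑ i, v i * a i = h := by
    rw [← Ideal.mem_span_range_iff_exists_fun]
    change h ∈ I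
    rw [hI]
    exact Submodule.mem_span_singleton_self h
  have hdv : ∀ i, h ∣ a i := by
    intro i
    have : a i ∈ I := Ideal.subset_span ⟨i, rfl⟩
    rw [hI] at this
    exact Ideal.mem_span_singleton.1 this
  choose c hc using hdv
  have hh0 : h ≠ 0 := by
    rintro rfl
    obtain ⟨i, hi⟩ := ha0
    exact hi (by simpa using hc i)
  -- Since a ≡ j·b mod N, g divides every a i, hence their gcd h. Passing to the primitive vector c
  -- = a/h therefore gains the factor g in the size bound.
  let g := Int.gcd j N
  have hgh : (g : ℤ) ∣ h := by
    rw [← hv₀]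
    refine Finset.dvd_sum fun i _ => Dvd.dvd.mul_left ?_ _
    have h1 : (g : ℤ) ∣ a i - j * b i := (Int.gcd_dvd_right j N).trans (hdvd i)
    have h2 : (g : ℤ) ∣ j * b i := (Int.gcd_dvd_left j N).mul_right _
    simpa using h1.add h2
  have hg0 : 0 < g := Int.gcd_pos_of_ne_zero_left _ hj0.ne'
  refine ⟨g, c, hg0, ⟨v₀, ?_⟩, fun i => ?_, fun v hv => ?_⟩
  · refine mul_left_cancel₀ hh0 ?_
    rw [mul_one, Finset.mul_sum]
    conv_rhs => rw [← hv₀]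
    refine Finset.sum_congr rfl fun i _ => ?_
    rw [hc i]
    ring
  · have h1 : (g : ℤ) * |c i| ≤ |a i| := by
      rw [hc i, abs_mul]
      refine mul_le_mul_of_nonneg_right ?_ (abs_nonneg _)
      exact Int.le_of_dvd (abs_pos.2 hh0) ((dvd_abs _ _).2 hgh)
    have h1' : (g : ℝ) * |(c i : ℝ)| ≤ |(a i : ℝ)| := by exact_mod_cast h1
    have h2 : (q : ℝ) * |(a i : ℝ)| ≤ N := by exact_mod_cast (hsmall i).le
    have hNpos : (0 : ℝ) < N := by exact_mod_cast hη
    -- The constant 2 is the loss in q + 1 ≤ 2q.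
    have h3 : (N : ℝ) ^ (1 / (k : ℝ)) ≤ 2 * q := by
      have h4 : (N : ℝ) ≤ ((q : ℝ) + 1) ^ k := by exact_mod_cast hNq
      have h5 : (N : ℝ) ^ (1 / (k : ℝ)) ≤ (q : ℝ) + 1 := by
        calc (N : ℝ) ^ (1 / (k : ℝ)) ≤ (((q : ℝ) + 1) ^ k) ^ (1 / (k : ℝ)) :=
              Real.rpow_le_rpow hNpos.le h4 (by positivity)
          _ = (q : ℝ) + 1 := by
              rw [one_div]
              exact Real.pow_rpow_inv_natCast (by positivity) hk
      have h6 : (1 : ℝ) ≤ q := by exact_mod_cast hq0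
      linarith
    have hpos : 0 < (N : ℝ) ^ (1 / (k : ℝ)) := Real.rpow_pos_of_pos hNpos _
    refine h1'.trans ?_
    rw [Real.rpow_sub hNpos, Real.rpow_one, ← mul_div_assoc, le_div_iff₀ hpos]
    calc |(a i : ℝ)| * (N : ℝ) ^ (1 / (k : ℝ)) ≤ |(a i : ℝ)| * (2 * q) :=
          mul_le_mul_of_nonneg_left h3 (abs_nonneg _)
      _ = 2 * (q * |(a i : ℝ)|) := by ring
      _ ≤ 2 * N := by linarith
  -- By Bézout, η^g = (η^j)^x, and η^j = ω^a, so η^g lies on the one-parameter subgroup of c.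
  -- Pairing with v, where c·v = 1, recovers its parameter.
  · let x := Int.gcdA j N
    have hbez : (g : ℤ) = j * x + N * Int.gcdB j N := Int.gcd_eq_gcd_ab j N
    have hηg : η ^ g = cochar c (ω ^ (h * x)) := by
      funext i
      have hηN : η i ^ (N : ℤ) = 1 := by
        rw [zpow_natCast]
        exact congrFun (pow_orderOf_eq_one η) i
      rw [Pi.pow_apply, ← zpow_natCast, hbez, zpow_add, zpow_mul, zpow_mul, hηN, one_zpow, mul_one,
        ← hpow, cochar, ← zpow_mul, ← zpow_mul, hc i]
      congr 1
      ring
    rw [mul_pow, inv_pow, cochar_pow, ← mon_pow, hηg, mon_cochar, hv, zpow_one, mul_inv_cancel]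

end lattice

/-! ### Torsion zeros of one Laurent polynomial -/

section count

variable {k : ℕ}

theorem mon_mul_cochar (ξ : Torus k K) (a u : Fin k → ℤ) (t : Kˣ) :
    mon (ξ * cochar a t) u = mon ξ u * t ^ (∑ i, a i * u i) := by
  rw [mon_mul, mon_cochar]

/-- As a·v = 1, the map (ξ, t) ↦ ξ·t^a embeds kernel × μ_g into μ_g^k. Cancelling |μ_g| ≤ g also
works when the characteristic divides g. -/
theorem finite_ncard_kernel_le {g : ℕ} (hg : 0 < g) {a v : Fin k → ℤ} (hav : ∑ i, a i * v i = 1) :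
    {ξ : Torus k K | ξ ^ g = 1 ∧ mon ξ v = 1}.Finite ∧
      {ξ : Torus k K | ξ ^ g = 1 ∧ mon ξ v = 1}.ncard ≤ g ^ (k - 1) := by
  classical
  obtain ⟨hf, hc⟩ := finite_roots_of_unity (K := K) hg
  have hk : k ≠ 0 := by
    rintro rfl
    simp at hav
  let μ := hf.toFinset
  have hμ : ∀ t, t ∈ μ ↔ t ^ g = 1 := fun t => by simp [μ]
  have hμg : μ.card ≤ g := by rwa [← Set.ncard_eq_toFinset_card _ hf]
  have hμ0 : 0 < μ.card := Finset.card_pos.2 ⟨1, (hμ 1).2 (one_pow g)⟩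
  let W : Finset (Torus k K) := Fintype.piFinset fun _ => μ
  have hW : ∀ z, z ∈ W ↔ z ^ g = 1 := by
    intro z
    rw [Fintype.mem_piFinset, funext_iff]
    exact forall_congr' fun i => hμ (z i)
  have hT : {ξ : Torus k K | ξ ^ g = 1 ∧ mon ξ v = 1} =
      (W.filter fun ξ => mon ξ v = 1 : Finset (Torus k K)) := by
    ext ξ
    simp [hW]
  rw [hT]
  refine ⟨Finset.finite_toSet _, ?_⟩
  rw [Set.ncard_coe_finset]
  have hle : ((W.filter fun ξ => mon ξ v = 1) ×ˢ μ).card ≤ W.card := by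
    refine Finset.card_le_card_of_injOn (fun p => p.1 * cochar a p.2) ?_ ?_
    · rintro ⟨ξ, t⟩ h
      simp only [Finset.coe_product, Set.mem_prod, Finset.mem_coe, Finset.mem_filter, hW, hμ] at h
      rw [Finset.mem_coe, hW, mul_pow, h.1.1, cochar_pow, h.2, one_mul]
      funext i
      simp [cochar]
    · rintro ⟨ξ, t⟩ h ⟨ξ', t'⟩ h' heq
      simp only [Finset.coe_product, Set.mem_prod, Finset.mem_coe, Finset.mem_filter, hW, hμ] at h h'
      simp only at heq
      have ht := congrArg (fun z => mon z v) heq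
      simp only [mon_mul_cochar, hav, zpow_one, h.1.2, h'.1.2, one_mul] at ht
      subst ht
      rw [mul_right_cancel heq]
  have hpow : μ.card ^ k = μ.card ^ (k - 1) * μ.card := by
    rw [← pow_succ, Nat.sub_add_cancel (Nat.one_le_iff_ne_zero.2 hk)]
  rw [Finset.card_product, Fintype.card_piFinset, Finset.prod_const, Finset.card_univ,
    Fintype.card_fin, hpow] at hle
  exact (Nat.le_of_mul_le_mul_right hle hμ0).trans (Nat.pow_le_pow_left hμg _)

/-- The zeros of `f` at which no proper partial sum of `f` vanishes. -/
def properZeros (f : Laurent k K) : Set (Torus k K) :=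
  {η | eval η f = 0 ∧ ∀ s ⊂ f.coeff.support, s.Nonempty →
    ∑ v ∈ s, f.coeff v * (mon η v : K) ≠ 0}

/-- Write η = ξ·t^a with t = η^v; there are at most g^(k-1) such ξ. On one coset f becomes a Laurent
polynomial in t with exponents at most D·B, and t determines η. As the support is in no hyperplane,
one of its coefficients is a proper partial sum of f, up to a power of t, hence nonzero. -/
theorem exists_coset_count (f : Laurent k K)
    (hf : ∀ a : Fin k → ℤ, a ≠ 0 → ∃ v ∈ f.coeff.support, ∃ w ∈ f.coeff.support,
      ∑ i, a i * v i ≠ ∑ i, a i * w i) :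
    ∃ D : ℕ, ∀ (g : ℕ) (a v : Fin k → ℤ) (B : ℕ), 0 < g → ∑ i, a i * v i = 1 →
      (∀ i, |a i| ≤ B) →
      {η ∈ properZeros f | (η * (cochar a (mon η v))⁻¹) ^ g = 1}.Finite ∧
      {η ∈ properZeros f | (η * (cochar a (mon η v))⁻¹) ^ g = 1}.ncard ≤
        D * B * g ^ (k - 1) := by
  classical
  let D := f.coeff.support.sup fun v => ∑ i, (v i).natAbs
  refine ⟨2 * D, fun g a v B hg hav hB => ?_⟩
  have hT := finite_ncard_kernel_le (K := K) hg hav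
  have ha0 : a ≠ 0 := by
    rintro rfl
    simp at hav
  have hbound : ∀ u ∈ f.coeff.support, |∑ i, a i * u i| ≤ (D * B : ℕ) := by
    intro u hu
    have h1 : ((∑ i, (u i).natAbs : ℕ) : ℤ) ≤ D := by
      exact_mod_cast Finset.le_sup (f := fun v : Fin k → ℤ => ∑ i, (v i).natAbs) hu
    calc |∑ i, a i * u i| ≤ ∑ i, |a i * u i| := Finset.abs_sum_le_sum_abs _ _
      _ ≤ ∑ i, |u i| * B := Finset.sum_le_sum fun i _ => by
          rw [abs_mul, mul_comm]
          exact mul_le_mul_of_nonneg_left (hB i) (abs_nonneg _)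
      _ = ((∑ i, (u i).natAbs : ℕ) : ℤ) * B := by
          rw [← Finset.sum_mul]
          push_cast
          rfl
      _ ≤ (D * B : ℕ) := by
          push_cast at h1 ⊢
          exact mul_le_mul_of_nonneg_right h1 (by positivity)
  have key := finite_ncard_le_of_fibers
    (S := {η ∈ properZeros f | (η * (cochar a (mon η v))⁻¹) ^ g = 1}) hT.1
    (fun η => η * (cochar a (mon η v))⁻¹) (fun η hη => ⟨hη.2, ?_⟩) (2 * (D * B)) ?_
  · refine ⟨key.1, key.2.trans ?_⟩
    rw [← mul_assoc 2 D B]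
    exact Nat.mul_le_mul_left _ hT.2
  · rw [mon_mul, mon_inv, mon_cochar, hav, zpow_one, mul_inv_cancel]
  · intro ξ _
    rcases Set.eq_empty_or_nonempty {x ∈ {η ∈ properZeros f |
      (η * (cochar a (mon η v))⁻¹) ^ g = 1} | x * (cochar a (mon x v))⁻¹ = ξ} with he | ⟨η, hη⟩
    · rw [he]
      simp
    have hdec : ∀ x : Torus k K, x * (cochar a (mon x v))⁻¹ = ξ → x = ξ * cochar a (mon x v) :=
      fun x hx => by rw [← hx, inv_mul_cancel_right]
    obtain ⟨u₀, hu₀, w₀, hw₀, hne⟩ := hf a ha0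
    have hsum : ∑ u ∈ f.coeff.support with ∑ i, a i * u i = ∑ i, a i * u₀ i,
        f.coeff u * (mon ξ u : K) ≠ 0 := by
      have h1 := hη.1.1.2 (f.coeff.support.filter fun u => ∑ i, a i * u i = ∑ i, a i * u₀ i)
        (Finset.filter_ssubset.2 ⟨w₀, hw₀, hne.symm⟩) ⟨u₀, Finset.mem_filter.2 ⟨hu₀, rfl⟩⟩
      intro h0
      apply h1
      have h2 := congrArg (· * ((mon η v ^ (∑ i, a i * u₀ i) : Kˣ) : K)) h0
      simp only [zero_mul, Finset.sum_mul] at h2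
      rw [← h2]
      refine Finset.sum_congr rfl fun u hu => ?_
      rw [Finset.mem_filter] at hu
      conv_lhs => rw [hdec η hη.2, mon_mul_cochar, hu.2]
      push_cast
      ring
    have hrc := root_count f.coeff.support (fun u => f.coeff u * (mon ξ u : K))
      (fun u => ∑ i, a i * u i) (D * B) hbound _ hsum
    have himg : (fun x => mon x v) '' {x ∈ {η ∈ properZeros f |
        (η * (cochar a (mon η v))⁻¹) ^ g = 1} | x * (cochar a (mon x v))⁻¹ = ξ} ⊆
        {t : Kˣ | ∑ u ∈ f.coeff.support, f.coeff u * (mon ξ u : K) *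
          ((t ^ (∑ i, a i * u i) : Kˣ) : K) = 0} := by
      rintro _ ⟨x, hx, rfl⟩
      have h1 := hx.1.1.1
      rw [eval_eq_sum] at h1
      simp only [Set.mem_ofPred_eq]
      rw [← h1]
      refine Finset.sum_congr rfl fun u _ => ?_
      conv_rhs => rw [hdec x hx.2, mon_mul_cochar]
      push_cast
      ring
    have hinj : Set.InjOn (fun x => mon x v) {x ∈ {η ∈ properZeros f |
        (η * (cochar a (mon η v))⁻¹) ^ g = 1} | x * (cochar a (mon x v))⁻¹ = ξ} := by
      intro x hx y hy hxy
      simp only at hxy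
      rw [hdec x hx.2, hdec y hy.2, hxy]
    refine ⟨(hrc.1.subset himg).of_finite_image hinj, ?_⟩
    rw [← hinj.ncard_image]
    exact (Set.ncard_le_ncard himg hrc.1).trans hrc.2

/-- The number of torsion points of order at most `T` among the proper zeros of `f`. -/
theorem exists_properZeros_count (hk : k ≠ 0) (f : Laurent k K)
    (hf : ∀ a : Fin k → ℤ, a ≠ 0 → ∃ v ∈ f.coeff.support, ∃ w ∈ f.coeff.support,
      ∑ i, a i * v i ≠ ∑ i, a i * w i) :
    ∃ c : ℝ, 0 ≤ c ∧ ∀ T : ℝ, 1 ≤ T → (torsionUpTo (properZeros f) T).Finite ∧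
      ((torsionUpTo (properZeros f) T).ncard : ℝ) ≤ c * T ^ ((k : ℝ) - 1 / k) := by
  classical
  obtain ⟨D, hD⟩ := exists_coset_count f hf
  have hsummable : Summable fun g : ℕ => 1 / (g : ℝ) ^ 2 :=
    Real.summable_one_div_nat_pow.2 one_lt_two
  have hk' : (k : ℝ) ≠ 0 := by exact_mod_cast hk
  -- For each g there are at most (3Q/g)^k vectors a, each contributing D·(Q/g)·g^(k-1) points:
  -- together 3^k·D·Q^(k+1)/g².
  refine ⟨3 ^ k * D * 2 ^ (k + 1) * ∑' g : ℕ, 1 / (g : ℝ) ^ 2,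
    mul_nonneg (by positivity) (tsum_nonneg fun g => by positivity), fun T hT => ?_⟩
  set Q : ℝ := 2 * T ^ (1 - 1 / (k : ℝ)) with hQ
  have hT0 : 0 < T := by linarith
  have hQ0 : 0 < Q := by positivity
  let B : ℕ → ℕ := fun g => ⌊Q / g⌋₊
  let box : ℕ → Finset (Fin k → ℤ) := fun g =>
    (Fintype.piFinset fun _ => Finset.Icc (-(B g : ℤ)) (B g)).filter
      fun a => ∃ v : Fin k → ℤ, ∑ i, a i * v i = 1
  -- Quantifying over all v makes `E g a` independent of a choice of dual vector.
  let E : ℕ → (Fin k → ℤ) → Set (Torus k K) := fun g a =>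
    {η ∈ properZeros f | ∀ v : Fin k → ℤ, ∑ i, a i * v i = 1 →
      (η * (cochar a (mon η v))⁻¹) ^ g = 1}
  have hE : ∀ g, 0 < g → ∀ a ∈ box g, (E g a).Finite ∧
      (E g a).ncard ≤ D * B g * g ^ (k - 1) := by
    intro g hg a ha
    obtain ⟨hab, v, hv⟩ := Finset.mem_filter.1 ha
    have h := hD g a v (B g) hg hv fun i => by
      have := Finset.mem_Icc.1 (Fintype.mem_piFinset.1 hab i)
      exact abs_le.2 this
    have hsub : E g a ⊆ {η ∈ properZeros f | (η * (cochar a (mon η v))⁻¹) ^ g = 1} :=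
      fun η hη => ⟨hη.1, hη.2 v hv⟩
    exact ⟨h.1.subset hsub, (Set.ncard_le_ncard hsub h.1).trans h.2⟩
  have hcover : torsionUpTo (properZeros f) T ⊆
      ⋃ g ∈ Finset.Icc 1 ⌊Q⌋₊, ⋃ a ∈ box g, E g a := by
    rintro η ⟨hη, hfin, hord⟩
    obtain ⟨g, a, hg, ⟨v, hv⟩, hga, hall⟩ := exists_cochar hk hfin.orderOf_pos
    have hg' : (0 : ℝ) < g := by exact_mod_cast hg
    have hQa : ∀ i, (g : ℝ) * |(a i : ℝ)| ≤ Q := fun i => by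
      refine (hga i).trans (mul_le_mul_of_nonneg_left ?_ zero_le_two)
      refine Real.rpow_le_rpow (by positivity) hord ?_
      have h1 : (1 : ℝ) ≤ k := by exact_mod_cast Nat.one_le_iff_ne_zero.2 hk
      have : 1 / (k : ℝ) ≤ 1 := by
        rw [div_le_one (by linarith)]
        exact h1
      linarith
    have hane : ∃ i, a i ≠ 0 := by
      by_contra! h
      simp [h] at hv
    simp only [Set.mem_iUnion]
    refine ⟨g, Finset.mem_Icc.2 ⟨hg, Nat.le_floor ?_⟩, a, Finset.mem_filter.2 ⟨?_, v, hv⟩, hη, hall⟩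
    · obtain ⟨i, hi⟩ := hane
      have h1 : (1 : ℝ) ≤ |(a i : ℝ)| := by exact_mod_cast Int.one_le_abs hi
      exact (le_mul_of_one_le_right hg'.le h1).trans (hQa i)
    · rw [Fintype.mem_piFinset]
      intro i
      rw [Finset.mem_Icc, ← abs_le]
      have h1 : (a i).natAbs ≤ B g := by
        refine Nat.le_floor ?_
        rw [le_div_iff₀ hg', Nat.cast_natAbs, Int.cast_abs, mul_comm]
        exact hQa i
      rw [Int.abs_eq_natAbs]
      exact_mod_cast h1
  have hfin : (⋃ g ∈ Finset.Icc 1 ⌊Q⌋₊, ⋃ a ∈ box g, E g a).Finite :=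
    Set.Finite.biUnion (Finset.finite_toSet _) fun g hg =>
      Set.Finite.biUnion (Finset.finite_toSet _) fun a ha =>
        (hE g (Finset.mem_Icc.1 hg).1 a ha).1
  refine ⟨hfin.subset hcover, ?_⟩
  have hnat : (torsionUpTo (properZeros f) T).ncard ≤
      ∑ g ∈ Finset.Icc 1 ⌊Q⌋₊, (2 * B g + 1) ^ k * (D * B g * g ^ (k - 1)) := by
    refine (Set.ncard_le_ncard hcover hfin).trans ((Finset.set_ncard_biUnion_le _ _).trans
      (Finset.sum_le_sum fun g hg => (Finset.set_ncard_biUnion_le _ _).trans ?_))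
    refine (Finset.sum_le_card_nsmul _ _ _ fun a ha =>
      (hE g (Finset.mem_Icc.1 hg).1 a ha).2).trans ?_
    rw [smul_eq_mul]
    refine Nat.mul_le_mul_right _ ((Finset.card_filter_le _ _).trans ?_)
    rw [Fintype.card_piFinset, Finset.prod_const, Int.card_Icc, Finset.card_univ, Fintype.card_fin]
    refine Nat.pow_le_pow_left ?_ _
    omega
  have hterm : ∀ g ∈ Finset.Icc 1 ⌊Q⌋₊,
      (((2 * B g + 1) ^ k * (D * B g * g ^ (k - 1)) : ℕ) : ℝ) ≤
        3 ^ k * D * Q ^ (k + 1) * (1 / (g : ℝ) ^ 2) := by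
    intro g hg
    obtain ⟨hg1, hg2⟩ := Finset.mem_Icc.1 hg
    have hgpos : (0 : ℝ) < g := by exact_mod_cast hg1
    have hgQ : (g : ℝ) ≤ Q := (Nat.le_floor_iff hQ0.le).1 hg2
    have hB : (B g : ℝ) ≤ Q / g := Nat.floor_le (by positivity)
    have h1 : 1 ≤ Q / g := (one_le_div hgpos).2 hgQ
    have h2 : (2 * (B g : ℝ) + 1) ≤ 3 * (Q / g) := by linarith
    obtain ⟨l, rfl⟩ := Nat.exists_eq_succ_of_ne_zero hk
    push_cast
    calc (2 * (B g : ℝ) + 1) ^ (l + 1) * (D * B g * (g : ℝ) ^ (l + 1 - 1))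
        ≤ (3 * (Q / g)) ^ (l + 1) * (D * (Q / g) * (g : ℝ) ^ l) := by
          rw [Nat.add_sub_cancel]
          gcongr
      _ = 3 ^ (l + 1) * D * Q ^ (l + 1 + 1) * (1 / (g : ℝ) ^ 2) := by
          rw [mul_pow, div_pow]
          field_simp
          ring
  calc ((torsionUpTo (properZeros f) T).ncard : ℝ)
      ≤ ((∑ g ∈ Finset.Icc 1 ⌊Q⌋₊, (2 * B g + 1) ^ k * (D * B g * g ^ (k - 1)) : ℕ) : ℝ) := by
        exact_mod_cast hnat
    _ ≤ ∑ g ∈ Finset.Icc 1 ⌊Q⌋₊, 3 ^ k * D * Q ^ (k + 1) * (1 / (g : ℝ) ^ 2) := by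
        rw [Nat.cast_sum]
        exact Finset.sum_le_sum hterm
    _ ≤ 3 ^ k * D * Q ^ (k + 1) * ∑' g : ℕ, 1 / (g : ℝ) ^ 2 := by
        rw [← Finset.mul_sum]
        refine mul_le_mul_of_nonneg_left ?_ (by positivity)
        exact hsummable.sum_le_tsum _ fun g _ => by positivity
    _ = 3 ^ k * D * 2 ^ (k + 1) * (∑' g : ℕ, 1 / (g : ℝ) ^ 2) * T ^ ((k : ℝ) - 1 / k) := by
        -- The exponent comes from (1 - 1/k)(k + 1) = k - 1/k.
        have hexp : (T ^ (1 - 1 / (k : ℝ))) ^ (k + 1) = T ^ ((k : ℝ) - 1 / k) := by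
          rw [← Real.rpow_natCast, ← Real.rpow_mul hT0.le]
          congr 1
          push_cast
          field_simp
          ring
        rw [hQ, mul_pow, hexp]
        ring

end count

/-! ### Characters constant on X and minimal dependent systems -/

section constant

variable {n k : ℕ}

/-- The exponents of the monomials that are constant on `X`. -/
def constLattice (X : Set (Torus n K)) : Submodule ℤ (Fin n → ℤ) where
  carrier := {u | ∀ x ∈ X, ∀ y ∈ X, mon x u = mon y u}
  add_mem' hu hv x hx y hy := by rw [mon_add, mon_add, hu x hx y hy, hv x hx y hy]
  zero_mem' x _ y _ := by simp
  smul_mem' c u hu x hx y hy := by rw [mon_zsmul, mon_zsmul, hu x hx y hy]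

/-- No nontrivial product of the monomials with exponents `A i` is constant on `X`. -/
def NoConst (X : Set (Torus n K)) (A : Fin k → Fin n → ℤ) : Prop :=
  ∀ w : Fin k → ℤ, ∑ i, w i • A i ∈ constLattice X → w = 0

/-- The product of all x^u - r, r ∈ R, lies in the prime vanishing ideal, so one factor does. -/
theorem mem_constLattice_of_finite {X : Set (Torus n K)} (hirr : IsIrreducible X)
    {u : Fin n → ℤ} (R : Finset Kˣ) (hR : ∀ x ∈ X, mon x u ∈ R) : u ∈ constLattice X := by
  have hp := vanIdeal_isPrime hirr
  have hmem : ∏ r ∈ R, (AddMonoidAlgebra.single u (1 : K) - algebraMap K (Laurent n K) (r : K)) ∈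
      vanIdeal X := by
    intro x hx
    rw [map_prod]
    refine Finset.prod_eq_zero (hR x hx) ?_
    rw [map_sub, eval_single, AlgHom.commutes]
    simp
  rw [Ideal.IsPrime.prod_mem_iff] at hmem
  obtain ⟨r, -, hr⟩ := hmem
  have key : ∀ x ∈ X, mon x u = r := by
    intro x hx
    have := hr x hx
    rw [map_sub, eval_single, AlgHom.commutes, one_mul, sub_eq_zero] at this
    exact Units.ext this
  intro x hx y hy
  rw [key x hx, key y hy]

theorem mem_constLattice_of_not_indep {X : Set (Torus n K)} (hirr : IsIrreducible X)
    {A : Fin 1 → Fin n → ℤ} (hA : ¬ Indep X A) : A 0 ∈ constLattice X := by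
  have hsnoc : A = (Fin.snoc (Fin.elim0 : Fin 0 → Fin n → ℤ) (A 0) : Fin 1 → Fin n → ℤ) := by
    funext i
    rw [Subsingleton.elim i 0]
    rfl
  rw [hsnoc] at hA
  obtain ⟨P, hP0, M, hM⟩ := exists_bound_of_not_indep_snoc hA
  have hev : eval (1 : Torus 0 K) P ≠ 0 := fun h => hP0 <|
    indep_zero hirr.1 (Fin.elim0 : Fin 0 → Fin n → ℤ) P fun x _ => by
      rw [Subsingleton.elim (monMap _ x) (1 : Torus 0 K), h]
  obtain ⟨R, -, hR⟩ := hM 1 hev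
  exact mem_constLattice_of_finite hirr R fun x hx => hR x hx (Subsingleton.elim _ _)

/-- If x^(cu) is constant, then x^u takes values in finitely many multiples of one value by roots of
unity. -/
theorem constLattice_saturated {X : Set (Torus n K)} (hirr : IsIrreducible X) {c : ℤ} (hc : c ≠ 0)
    {u : Fin n → ℤ} (hu : c • u ∈ constLattice X) : u ∈ constLattice X := by
  classical
  obtain ⟨x₀, hx₀⟩ := hirr.1
  have hf := (finite_roots_of_unity (K := K) (Int.natAbs_pos.2 hc)).1
  refine mem_constLattice_of_finite hirr (hf.toFinset.image fun t => t * mon x₀ u) fun x hx => ?_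
  refine Finset.mem_image.2 ⟨mon x u / mon x₀ u, ?_, div_mul_cancel _ _⟩
  rw [Set.Finite.mem_toFinset]
  have h := hu x hx x₀ hx₀
  rw [mon_zsmul, mon_zsmul] at h
  have h1 : (mon x u / mon x₀ u) ^ c = 1 := by rw [div_zpow, h, div_self']
  rcases Int.natAbs_eq c with h2 | h2 <;> rw [h2] at h1
  · simpa using h1
  · simpa using h1

/-- A is a lifted basis of ℤⁿ modulo the constant lattice, free by saturation. If A were independent
on X, then X = ζG, where G is the common kernel of the constant characters. -/
theorem exists_noConst_not_indep {X : Set (Torus n K)} (hX : IsClosed X) (hirr : IsIrreducible X)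
    {ζ : Torus n K} (hζ : ζ ∈ X) (hfin : IsOfFinOrder ζ) (hcoset : ¬ IsTorsionCoset X) :
    ∃ (k : ℕ) (A : Fin k → Fin n → ℤ), NoConst X A ∧ ¬ Indep X A := by
  classical
  set Λ := constLattice X with hΛ
  have htf : Module.IsTorsionFree ℤ ((Fin n → ℤ) ⧸ Λ) := by
    rw [Module.isTorsionFree_iff_smul_eq_zero]
    intro c q hcq
    obtain ⟨u, rfl⟩ := Submodule.mkQ_surjective Λ q
    by_cases hc : c = 0
    · exact Or.inl hc
    · right
      rw [← map_smul, Submodule.mkQ_apply, Submodule.Quotient.mk_eq_zero] at hcq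
      rw [Submodule.mkQ_apply, Submodule.Quotient.mk_eq_zero]
      exact constLattice_saturated hirr hc hcq
  have hfree : Module.Free ℤ ((Fin n → ℤ) ⧸ Λ) := Module.free_of_finite_type_torsion_free'
  let b := Module.finBasis ℤ ((Fin n → ℤ) ⧸ Λ)
  choose A hA using fun i => Submodule.mkQ_surjective Λ (b i)
  refine ⟨_, A, fun w hw => ?_, fun hind => hcoset ?_⟩
  · rw [← hΛ, ← Submodule.Quotient.mk_eq_zero, ← Submodule.mkQ_apply, map_sum] at hw
    simp only [map_smul, hA] at hw
    exact funext (Fintype.linearIndependent_iff.1 b.linearIndependent w hw)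
  · let w : (Fin n → ℤ) → Fin (Module.finrank ℤ ((Fin n → ℤ) ⧸ Λ)) → ℤ :=
      fun u => b.repr (Λ.mkQ u)
    have hw : ∀ u, u - ∑ i, w u i • A i ∈ Λ := by
      intro u
      rw [← Submodule.Quotient.mk_eq_zero, ← Submodule.mkQ_apply, map_sub, map_sum]
      simp only [map_smul, hA]
      rw [b.sum_repr, sub_self]
    let G : Subgroup (Torus n K) :=
      { carrier := {x | ∀ u ∈ Λ, mon x u = 1}
        mul_mem' := fun hx hy u hu => by rw [mon_mul, hx u hu, hy u hu, one_mul]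
        one_mem' := fun u _ => mon_one u
        inv_mem' := fun hx u hu => by rw [mon_inv, hx u hu, inv_one] }
    have hXG : ∀ x ∈ X, ζ⁻¹ * x ∈ G := by
      intro x hx u hu
      rw [mon_mul, mon_inv, hu x hx ζ hζ, inv_mul_cancel]
    have hGX : ∀ y ∈ G, ζ * y ∈ X := by
      intro y hy
      refine mem_of_vanIdeal hX fun P hP => ?_
      -- On ζG constant characters take their value at ζ, so P becomes a Laurent polynomial in the
      -- monomials A. It vanishes on X ⊆ ζG, hence is zero by independence, and P vanishes on all of
      -- ζG.
      let P' : Laurent (Module.finrank ℤ ((Fin n → ℤ) ⧸ Λ)) K := ∑ u ∈ P.coeff.support,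
        AddMonoidAlgebra.single (w u) (P.coeff u * (mon ζ (u - ∑ i, w u i • A i) : K))
      have hP' : ∀ z ∈ G, eval (monMap A (ζ * z)) P' = eval (ζ * z) P := by
        intro z hz
        rw [eval_eq_sum _ P, map_sum]
        refine Finset.sum_congr rfl fun u _ => ?_
        have h1 : mon (ζ * z) u = mon ζ (u - ∑ i, w u i • A i) * mon (ζ * z) (∑ i, w u i • A i) := by
          conv_lhs => rw [← sub_add_cancel u (∑ i, w u i • A i), mon_add, mon_mul,
            hz _ (hw u), mul_one]
        rw [eval_single, mon_monMap, h1]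
        push_cast
        ring
      have hP0 : P' = 0 := by
        refine hind P' fun x hx => ?_
        have := hP' _ (hXG x hx)
        rw [mul_inv_cancel_left] at this
        rw [this]
        exact hP x hx
      rw [← hP' y hy, hP0, map_zero]
    refine ⟨ζ, G, hfin, ⟨?_, ?_⟩, ?_⟩
    · convert isAlgebraic_zeroLocus
        ((fun u : Fin n → ℤ => AddMonoidAlgebra.single u (1 : K) - 1) '' (Λ : Set (Fin n → ℤ)))
        using 1
      ext x
      simp only [SetLike.mem_coe, Set.forall_mem_image, map_sub, eval_single, map_one, one_mul,
        Set.mem_ofPred_eq, sub_eq_zero, Units.val_eq_one]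
      rfl
    · have : (G : Set (Torus n K)) = (fun x => ζ⁻¹ * x) '' X := by
        ext y
        constructor
        · intro hy
          exact ⟨ζ * y, hGX y hy, inv_mul_cancel_left _ _⟩
        · rintro ⟨x, hx, rfl⟩
          exact hXG x hx
      rw [this]
      exact hirr.image _ (continuous_mul_left_torus _).continuousOn
    · ext x
      constructor
      · intro hx
        exact ⟨ζ⁻¹ * x, hXG x hx, mul_inv_cancel_left _ _⟩
      · rintro ⟨y, hy, rfl⟩
        exact hGX y hy

/-- If the support of a relation between monomials is contained in an affine hyperplane, there is
a relation between fewer monomials. -/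
theorem exists_fewer_of_homogeneous {X : Set (Torus n K)} {A : Fin k → Fin n → ℤ}
    (hA : NoConst X A) {f : Laurent k K} (hf0 : f ≠ 0)
    (hf : ∀ x ∈ X, eval (monMap A x) f = 0) {a : Fin k → ℤ} (ha : a ≠ 0)
    (hom : ∀ v ∈ f.coeff.support, ∀ w ∈ f.coeff.support, ∑ i, a i * v i = ∑ i, a i * w i) :
    ∃ r < k, ∃ A' : Fin r → Fin n → ℤ, NoConst X A' ∧ ¬ Indep X A' := by
  classical
  let φ : (Fin k → ℤ) →ₗ[ℤ] ℤ := Fintype.linearCombination ℤ a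
  have hφ : ∀ v, φ v = ∑ i, a i * v i := fun v => by
    simp [φ, Fintype.linearCombination_apply, mul_comm]
  -- After division by the monomial of v₀ all exponents of f lie in L, of rank below k; a basis of L
  -- supplies the fewer monomials.
  let L := LinearMap.ker φ
  have hr : Module.finrank ℤ L < k := by
    have h1 := Submodule.finrank_quotient_add_finrank L
    rw [Module.finrank_fin_fun] at h1
    have h2 : 0 < Module.finrank ℤ ((Fin k → ℤ) ⧸ L) := by
      rw [(LinearMap.quotKerEquivRange φ).finrank_eq]
      obtain ⟨i, hi⟩ := Function.ne_iff.1 ha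
      refine Module.finrank_pos_iff_exists_ne_zero.2 ⟨⟨φ (Pi.single i 1), ⟨_, rfl⟩⟩, fun h => hi ?_⟩
      have := congrArg Subtype.val h
      simpa [hφ, Pi.single_apply] using this
    omega
  let b := Module.finBasis ℤ L
  have hf0' : f.coeff ≠ 0 := by simpa using hf0
  obtain ⟨v₀, hv₀⟩ := Finsupp.support_nonempty_iff.2 hf0'
  let A' : Fin (Module.finrank ℤ L) → Fin n → ℤ := fun l => ∑ i, (b l : Fin k → ℤ) i • A i
  have hcomb : ∀ w : Fin (Module.finrank ℤ L) → ℤ, ∑ l, w l • A' l =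
      ∑ i, ((∑ l, w l • b l : L) : Fin k → ℤ) i • A i := by
    intro w
    simp only [A', Finset.smul_sum, Submodule.coe_sum, Submodule.coe_smul, Finset.sum_apply,
      Pi.smul_apply, Finset.sum_smul, smul_assoc]
    exact Finset.sum_comm
  have hex : ∀ v : Fin k → ℤ, ∃ w : Fin (Module.finrank ℤ L) → ℤ, v ∈ f.coeff.support →
      ((∑ l, w l • b l : L) : Fin k → ℤ) = v - v₀ := by
    intro v
    by_cases hv : v ∈ f.coeff.support
    · have hmem : v - v₀ ∈ L := by
        rw [LinearMap.mem_ker, map_sub, hφ, hφ, hom v hv v₀ hv₀, sub_self]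
      exact ⟨b.repr ⟨v - v₀, hmem⟩, fun _ => by rw [b.sum_repr]⟩
    · exact ⟨0, fun h => absurd h hv⟩
  choose w hw using hex
  refine ⟨_, hr, A', fun c hc => ?_, fun hind => ?_⟩
  · rw [hcomb] at hc
    have h1 := hA _ hc
    exact funext (Fintype.linearIndependent_iff.1 b.linearIndependent c (Subtype.ext h1))
  · let f' : Laurent (Module.finrank ℤ L) K :=
      ∑ v ∈ f.coeff.support, AddMonoidAlgebra.single (w v) (f.coeff v)
    have hinj : ∀ v ∈ f.coeff.support, w v = w v₀ → v = v₀ := by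
      intro v hv h
      have h1 := hw v hv
      rw [h, hw v₀ hv₀, sub_self] at h1
      exact (sub_eq_zero.1 h1.symm)
    have hcoeff : f'.coeff (w v₀) = f.coeff v₀ := by
      simp only [f', AddMonoidAlgebra.coeff_sum, AddMonoidAlgebra.coeff_single,
        Finsupp.finsetSum_apply, Finsupp.single_apply]
      rw [Finset.sum_eq_single v₀]
      · simp
      · exact fun v hv hne => if_neg fun h => hne (hinj v hv h)
      · exact fun h => absurd hv₀ h
    have hzero : f' = 0 := by
      refine hind f' fun x hx => ?_
      have h1 := hf x hx
      rw [eval_eq_sum] at h1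
      have h2 := congrArg (· * (((mon (monMap A x) v₀)⁻¹ : Kˣ) : K)) h1
      simp only [zero_mul, Finset.sum_mul] at h2
      rw [map_sum, ← h2]
      refine Finset.sum_congr rfl fun v hv => ?_
      rw [eval_single, mon_monMap, hcomb, hw v hv, ← mon_monMap, mon_sub, div_eq_mul_inv]
      push_cast
      ring
    rw [hzero] at hcoeff
    exact Finsupp.mem_support_iff.1 hv₀ (by simpa using hcoeff.symm)

end constant

/-! ### Transfer to X and the final count -/

variable {n k : ℕ}

/-- The trivial bound, summed over all orders up to `T`. -/
theorem exists_torsionUpTo_bound [IsAlgClosed K] {d : ℕ} (hd : 0 < d) {Y : Set (Torus n K)}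
    (hY : IsClosed Y) (hYd : dim Y < d) :
    ∃ c : ℝ, 0 ≤ c ∧ ∀ T : ℝ, 1 ≤ T → (torsionUpTo Y T).Finite ∧
      ((torsionUpTo Y T).ncard : ℝ) ≤ c * T ^ (d : ℝ) := by
  obtain ⟨c, hc⟩ := exists_torsion_bound d Y hY hYd
  obtain ⟨e, rfl⟩ := Nat.exists_eq_succ_of_ne_zero hd.ne'
  refine ⟨c, by positivity, fun T hT => ?_⟩
  have hT0 : 0 ≤ T := by linarith
  have hcover : torsionUpTo Y T ⊆ ⋃ N ∈ Finset.Icc 1 ⌊T⌋₊, {x ∈ Y | x ^ N = 1} := by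
    rintro x ⟨hx, hfin, hord⟩
    simp only [Set.mem_iUnion]
    exact ⟨orderOf x, Finset.mem_Icc.2 ⟨hfin.orderOf_pos, Nat.le_floor hord⟩, hx,
      pow_orderOf_eq_one x⟩
  have hfin : (⋃ N ∈ Finset.Icc 1 ⌊T⌋₊, {x ∈ Y | x ^ N = 1}).Finite :=
    Set.Finite.biUnion (Finset.finite_toSet _) fun N hN => (hc N (Finset.mem_Icc.1 hN).1).1
  refine ⟨hfin.subset hcover, ?_⟩
  have hnat : (torsionUpTo Y T).ncard ≤ ⌊T⌋₊ * (c * ⌊T⌋₊ ^ e) := by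
    refine (Set.ncard_le_ncard hcover hfin).trans ((Finset.set_ncard_biUnion_le _ _).trans ?_)
    have := Finset.sum_le_card_nsmul (Finset.Icc 1 ⌊T⌋₊) (fun N => {x ∈ Y | x ^ N = 1}.ncard)
      (c * ⌊T⌋₊ ^ e) fun N hN => by
        obtain ⟨h1, h2⟩ := Finset.mem_Icc.1 hN
        have h3 := (hc N h1).2
        rw [Nat.succ_eq_add_one, pow_succ', mul_left_comm] at h3
        exact (Nat.le_of_mul_le_mul_left h3 h1).trans
          (Nat.mul_le_mul_left _ (Nat.pow_le_pow_left h2 e))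
    simpa using this
  calc ((torsionUpTo Y T).ncard : ℝ) ≤ ((⌊T⌋₊ * (c * ⌊T⌋₊ ^ e) : ℕ) : ℝ) := by exact_mod_cast hnat
    _ = (c : ℝ) * (⌊T⌋₊ : ℝ) ^ (e + 1) := by
        push_cast
        ring
    _ ≤ c * T ^ (e + 1) := by
        gcongr
        exact Nat.floor_le hT0
    _ = c * T ^ ((e.succ : ℕ) : ℝ) := by rw [Real.rpow_natCast]

/-- Counting pairs of a torsion point and a multiple of its order. -/
theorem exists_pairs_bound {Z : Set (Torus k K)} {e c : ℝ} (he : 1 < e) (hc : 0 ≤ c)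
    (hZ : ∀ T : ℝ, 1 ≤ T → (torsionUpTo Z T).Finite ∧ ((torsionUpTo Z T).ncard : ℝ) ≤ c * T ^ e) :
    ∃ c' : ℝ, 0 ≤ c' ∧ ∀ T : ℝ, 1 ≤ T →
      {p : ℕ × Torus k K | (0 < p.1 ∧ (p.1 : ℝ) ≤ T) ∧ p.2 ∈ Z ∧ p.2 ^ p.1 = 1}.Finite ∧
      ({p : ℕ × Torus k K | (0 < p.1 ∧ (p.1 : ℝ) ≤ T) ∧ p.2 ∈ Z ∧ p.2 ^ p.1 = 1}.ncard : ℝ) ≤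
        c' * T ^ e := by
  have hsum : Summable fun q : ℕ => 1 / (q : ℝ) ^ e := Real.summable_one_div_nat_rpow.2 he
  refine ⟨c * ∑' q : ℕ, 1 / (q : ℝ) ^ e, mul_nonneg hc (tsum_nonneg fun q => by positivity),
    fun T hT => ?_⟩
  have hT0 : 0 ≤ T := by linarith
  have hq : ∀ q ∈ Finset.Icc 1 ⌊T⌋₊, (0 : ℝ) < q ∧ 1 ≤ T / q := by
    intro q hq
    obtain ⟨h1, h2⟩ := Finset.mem_Icc.1 hq
    have h3 : (0 : ℝ) < q := by exact_mod_cast h1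
    exact ⟨h3, (one_le_div h3).2 ((Nat.le_floor_iff hT0).1 h2)⟩
  -- Pairs (N, y) are sorted by q = N / ord y, so ord y ≤ T/q; the sum over q converges because e >
  -- 1.
  let F : ℕ → Set (ℕ × Torus k K) := fun q =>
    (fun y => (q * orderOf y, y)) '' torsionUpTo Z (T / q)
  have hcover : {p : ℕ × Torus k K | (0 < p.1 ∧ (p.1 : ℝ) ≤ T) ∧ p.2 ∈ Z ∧ p.2 ^ p.1 = 1} ⊆
      ⋃ q ∈ Finset.Icc 1 ⌊T⌋₊, F q := by
    rintro ⟨N, y⟩ ⟨⟨hN, hNT⟩, hy, hyN⟩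
    simp only at hN hNT hy hyN
    have hfin : IsOfFinOrder y := isOfFinOrder_iff_pow_eq_one.2 ⟨N, hN, hyN⟩
    obtain ⟨q, rfl⟩ := orderOf_dvd_of_pow_eq_one hyN
    have hq0 : 0 < q := Nat.pos_of_mul_pos_left hN
    have hqr : (0 : ℝ) < q := by exact_mod_cast hq0
    have ho : (1 : ℝ) ≤ orderOf y := by exact_mod_cast hfin.orderOf_pos
    push_cast at hNT
    simp only [Set.mem_iUnion]
    refine ⟨q, Finset.mem_Icc.2 ⟨hq0, Nat.le_floor ?_⟩, y, ⟨hy, hfin, ?_⟩, by rw [mul_comm]⟩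
    · exact (le_mul_of_one_le_left hqr.le ho).trans hNT
    · rwa [le_div_iff₀ hqr]
  have hfin : (⋃ q ∈ Finset.Icc 1 ⌊T⌋₊, F q).Finite :=
    Set.Finite.biUnion (Finset.finite_toSet _) fun q hq' => ((hZ _ (hq q hq').2).1).image _
  refine ⟨hfin.subset hcover, ?_⟩
  have hnat := (Set.ncard_le_ncard hcover hfin).trans (Finset.set_ncard_biUnion_le _ _)
  calc _ ≤ ((∑ q ∈ Finset.Icc 1 ⌊T⌋₊, (F q).ncard : ℕ) : ℝ) := by exact_mod_cast hnat
    _ ≤ ∑ q ∈ Finset.Icc 1 ⌊T⌋₊, c * T ^ e * (1 / (q : ℝ) ^ e) := by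
        rw [Nat.cast_sum]
        refine Finset.sum_le_sum fun q hq' => ?_
        obtain ⟨h1, h2⟩ := hq q hq'
        have h3 := hZ _ h2
        calc ((F q).ncard : ℝ) ≤ ((torsionUpTo Z (T / q)).ncard : ℝ) := by
              exact_mod_cast Set.ncard_image_le h3.1
          _ ≤ c * (T / q) ^ e := h3.2
          _ = c * T ^ e * (1 / (q : ℝ) ^ e) := by
              rw [Real.div_rpow hT0 h1.le]
              ring
    _ ≤ c * T ^ e * ∑' q : ℕ, 1 / (q : ℝ) ^ e := by
        rw [← Finset.mul_sum]
        exact mul_le_mul_of_nonneg_left (hsum.sum_le_tsum _ fun q _ => by positivity)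
          (by positivity)
    _ = _ := by ring

/-- A relation between the monomials `A i` whose proper partial sums are not relations. -/
theorem exists_minimal_relation {X : Set (Torus n K)} {A : Fin k → Fin n → ℤ} (hA : ¬ Indep X A) :
    ∃ f : Laurent k K, f ≠ 0 ∧ (∀ x ∈ X, eval (monMap A x) f = 0) ∧
      ∀ s ⊂ f.coeff.support, s.Nonempty →
        pull A (∑ v ∈ s, AddMonoidAlgebra.single v (f.coeff v)) ∉ vanIdeal X := by
  classical
  -- A relation with the fewest terms: a vanishing proper partial sum would be shorter.
  have hex : ∃ N : ℕ, ∃ f : Laurent k K, f ≠ 0 ∧ (∀ x ∈ X, eval (monMap A x) f = 0) ∧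
      f.coeff.support.card = N := by
    simp only [Indep, not_forall] at hA
    obtain ⟨f, hf, hf0⟩ := hA
    exact ⟨_, f, hf0, hf, rfl⟩
  obtain ⟨f, hf0, hf, hcard⟩ := Nat.find_spec hex
  refine ⟨f, hf0, hf, fun s hs ⟨v₀, hv₀⟩ hmem => ?_⟩
  set h : Laurent k K := ∑ v ∈ s, AddMonoidAlgebra.single v (f.coeff v) with hh
  have hcoeff : ∀ v, h.coeff v = if v ∈ s then f.coeff v else 0 := by
    intro v
    simp [hh, AddMonoidAlgebra.coeff_sum, Finsupp.single_apply]
  have hsupp : h.coeff.support ⊆ s := by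
    intro v hv
    by_contra hvs
    rw [Finsupp.mem_support_iff, hcoeff, if_neg hvs] at hv
    exact hv rfl
  have hlt : h.coeff.support.card < Nat.find hex :=
    hcard ▸ (Finset.card_le_card hsupp).trans_lt (Finset.card_lt_card hs)
  refine Nat.find_min hex hlt ⟨h, fun h0 => ?_, fun x hx => ?_, rfl⟩
  · have := hcoeff v₀
    rw [h0, if_pos hv₀] at this
    exact Finsupp.mem_support_iff.1 (hs.subset hv₀) (by simpa using this.symm)
  · rw [← eval_pull]
    exact hmem x hx

/-- The number of torsion points of order at most `T` on `X`, outside a proper closed subset. -/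
theorem exists_generic_bound {X Y : Set (Torus n K)} {p m C : ℕ} (hp : 0 < p) (hpm : p ≤ m)
    {A : Fin (p + 1) → Fin n → ℤ} {B : Fin m → Fin n → ℤ}
    (hBA : ∀ i, B (Fin.castLE hpm i) = A i.castSucc)
    (hC : ∀ z : Torus m K, {x | (x ∈ X ∧ x ∉ Y) ∧ monMap B x = z}.Finite ∧
      {x | (x ∈ X ∧ x ∉ Y) ∧ monMap B x = z}.ncard ≤ C)
    {f : Laurent (p + 1) K} (hf : ∀ a : Fin (p + 1) → ℤ, a ≠ 0 → ∃ v ∈ f.coeff.support,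
      ∃ w ∈ f.coeff.support, ∑ i, a i * v i ≠ ∑ i, a i * w i) :
    ∃ c : ℝ, 0 ≤ c ∧ ∀ T : ℝ, 1 ≤ T →
      (torsionUpTo {x | (x ∈ X ∧ x ∉ Y) ∧ monMap A x ∈ properZeros f} T).Finite ∧
      ((torsionUpTo {x | (x ∈ X ∧ x ∉ Y) ∧ monMap A x ∈ properZeros f} T).ncard : ℝ) ≤
        c * T ^ ((m : ℝ) + 1 - 1 / ((p : ℝ) + 1)) := by
  obtain ⟨c₁, hc₁, h₁⟩ := exists_properZeros_count (Nat.succ_ne_zero p) f hf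
  have hp' : (1 : ℝ) ≤ p := by exact_mod_cast hp
  have he : 1 < ((p + 1 : ℕ) : ℝ) - 1 / ((p + 1 : ℕ) : ℝ) := by
    push_cast
    have : 1 / ((p : ℝ) + 1) < 1 := by
      rw [div_lt_one (by linarith)]
      linarith
    linarith
  obtain ⟨c₂, hc₂, h₂⟩ := exists_pairs_bound he hc₁ h₁
  refine ⟨C * c₂, by positivity, fun T hT => ?_⟩
  have hT0 : 0 < T := by linarith
  obtain ⟨hpairs, hpairs_card⟩ := h₂ T hT
  set Pairs := {q : ℕ × Torus (p + 1) K | (0 < q.1 ∧ (q.1 : ℝ) ≤ T) ∧ q.2 ∈ properZeros f ∧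
    q.2 ^ q.1 = 1} with hPairs
  set W := torsionUpTo {x | (x ∈ X ∧ x ∉ Y) ∧ monMap A x ∈ properZeros f} T with hW
  -- The order N is recorded with the point y. Then y fixes the first p coordinates under B, and the
  -- other m - p are N-th roots of unity with N ≤ T.
  have key := finite_ncard_le_of_fibers (S := W) hpairs (fun x => (orderOf x, monMap A x)) ?_
    (C * ⌊T⌋₊ ^ (m - p)) ?_
  · refine ⟨key.1, ?_⟩
    calc (W.ncard : ℝ) ≤ ((C * ⌊T⌋₊ ^ (m - p) * Pairs.ncard : ℕ) : ℝ) := by exact_mod_cast key.2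
      _ = C * (⌊T⌋₊ : ℝ) ^ (m - p) * Pairs.ncard := by push_cast; ring
      _ ≤ C * T ^ (m - p) * (c₂ * T ^ (((p + 1 : ℕ) : ℝ) - 1 / ((p + 1 : ℕ) : ℝ))) := by
          gcongr
          exact Nat.floor_le hT0.le
      _ = C * c₂ * (T ^ (((m - p : ℕ) : ℝ)) * T ^ (((p + 1 : ℕ) : ℝ) - 1 / ((p + 1 : ℕ) : ℝ))) := by
          rw [Real.rpow_natCast]
          ring
      _ = C * c₂ * T ^ ((m : ℝ) + 1 - 1 / ((p : ℝ) + 1)) := by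
          rw [← Real.rpow_add hT0, Nat.cast_sub hpm]
          push_cast
          congr 2
          ring
  · rintro x ⟨⟨-, hx⟩, hfin, hord⟩
    exact ⟨⟨hfin.orderOf_pos, hord⟩, hx, by
      simp only
      rw [← monMap_pow, pow_orderOf_eq_one, monMap_one]⟩
  · rintro ⟨N, y⟩ ⟨⟨hN, hNT⟩, -, -⟩
    simp only at hN hNT
    have hcount := finite_ncard_torsion_le hpm (fun i => y i.castSucc) hN
    have h := finite_ncard_le_of_fibers
      (S := {x ∈ W | (orderOf x, monMap A x) = (N, y)}) hcount.1 (monMap B) ?_ C ?_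
    · refine ⟨h.1, h.2.trans (Nat.mul_le_mul_left _ (hcount.2.trans ?_))⟩
      exact Nat.pow_le_pow_left (Nat.le_floor hNT) _
    · rintro x ⟨-, hx⟩
      obtain ⟨rfl, rfl⟩ := Prod.mk.inj hx
      refine ⟨by rw [← monMap_pow, pow_orderOf_eq_one, monMap_one], fun i => ?_⟩
      simp only [monMap, hBA]
    · intro z _
      have hsub : {x ∈ {x ∈ W | (orderOf x, monMap A x) = (N, y)} | monMap B x = z} ⊆
          {x | (x ∈ X ∧ x ∉ Y) ∧ monMap B x = z} := fun x hx => ⟨hx.1.1.1.1, hx.2⟩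
      exact ⟨(hC z).1.subset hsub, (Set.ncard_le_ncard hsub (hC z).1).trans (hC z).2⟩

theorem exists_torsion_count [IsAlgClosed K] {X : Set (Torus n K)} (hX : IsClosed X)
    (hirr : IsIrreducible X) (hcoset : ¬ IsTorsionCoset X) {d : ℕ} (hd : dim X = d)
    {ζ : Torus n K} (hζ : ζ ∈ X) (hfin : IsOfFinOrder ζ) :
    ∃ c : ℝ, ∀ T : ℝ, 1 ≤ T → (torsionUpTo X T).Finite ∧
      ((torsionUpTo X T).ncard : ℝ) ≤ c * T ^ ((d : ℝ) + 1 - 1 / ((d : ℝ) + 1)) := by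
  classical
  have hex : ∃ k : ℕ, ∃ A : Fin k → Fin n → ℤ, NoConst X A ∧ ¬ Indep X A :=
    exists_noConst_not_indep hX hirr hζ hfin hcoset
  obtain ⟨k, ⟨A, hA, hAdep⟩, hmin⟩ : ∃ k : ℕ, (∃ A : Fin k → Fin n → ℤ, NoConst X A ∧ ¬ Indep X A) ∧
      ∀ r < k, ¬ ∃ A : Fin r → Fin n → ℤ, NoConst X A ∧ ¬ Indep X A :=
    ⟨Nat.find hex, Nat.find_spec hex, fun r hr => Nat.find_min hex hr⟩
  have hk0 : k ≠ 0 := by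
    rintro rfl
    exact hAdep (indep_zero hirr.1 A)
  obtain ⟨p, rfl⟩ := Nat.exists_eq_succ_of_ne_zero hk0
  -- A single dependent monomial is constant, which `NoConst` excludes.
  have hp : 0 < p := by
    rw [Nat.pos_iff_ne_zero]
    rintro rfl
    have h1 := hA 1 (by simpa using mem_constLattice_of_not_indep hirr hAdep)
    exact one_ne_zero (congrFun h1 0)
  obtain ⟨f, hf0, hf, hpart⟩ := exists_minimal_relation hAdep
  have hhom : ∀ a : Fin (p + 1) → ℤ, a ≠ 0 → ∃ v ∈ f.coeff.support,
      ∃ w ∈ f.coeff.support, ∑ i, a i * v i ≠ ∑ i, a i * w i := by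
    intro a ha
    by_contra! hcon
    obtain ⟨r, hr, hA'⟩ := exists_fewer_of_homogeneous hA hf0 hf ha hcon
    exact hmin r hr hA'
  -- A subfamily inherits `NoConst`, so by minimality of p + 1 it is independent.
  have hAinit : Indep X fun i : Fin p => A i.castSucc := by
    by_contra hcon
    refine hmin p (Nat.lt_succ_self p) ⟨_, fun w hw => ?_, hcon⟩
    have h1 := hA (Fin.snoc w 0 : Fin (p + 1) → ℤ) (by simpa [Fin.sum_univ_castSucc] using hw)
    funext i
    have := congrFun h1 i.castSucc
    simpa using this
  obtain ⟨m, hpm, B, hmd, hBA, hB, hBmax⟩ := exists_maximal_indep hX hirr hd.le _ hAinit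
  obtain ⟨C, Y, hY, hYX, hC⟩ := exists_fiber_bound hX hirr hB hBmax
  let S := f.coeff.support.ssubsets.filter Finset.Nonempty
  -- Off the zeros of Q no nonempty proper partial sum of f vanishes, so these points of X map to
  -- proper zeros.
  let Q : Laurent n K :=
    ∏ s ∈ S, pull A (∑ v ∈ s, AddMonoidAlgebra.single v (f.coeff v))
  have hQ : Q ∉ vanIdeal X := by
    have hprime := vanIdeal_isPrime hirr
    intro h
    simp only [Q, Ideal.IsPrime.prod_mem_iff] at h
    obtain ⟨s, hs, hmem⟩ := h
    obtain ⟨hs1, hs2⟩ := Finset.mem_filter.1 hs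
    exact hpart s (Finset.mem_ssubsets.1 hs1) hs2 hmem
  let Y' := X ∩ {x | eval x Q = 0}
  have hY' : IsClosed Y' := hX.inter (isClosed_zeros Q)
  have hYX' : Y' ⊂ X := ⟨Set.inter_subset_left, fun h => hQ fun x hx => (h hx).2⟩
  have hdpos : 0 < d := by omega
  have hlt : ∀ Z : Set (Torus n K), IsClosed Z → Z ⊂ X → dim Z < d := by
    intro Z hZ hZX
    by_contra! hcon
    have h1 := (add_le_add_left hcon 1).trans (dim_add_one_le hirr hZ hZX)
    rw [hd] at h1
    have : d + 1 ≤ d := by exact_mod_cast h1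
    omega
  obtain ⟨c₁, hc₁, h₁⟩ := exists_torsionUpTo_bound hdpos hY (hlt Y hY hYX)
  obtain ⟨c₂, hc₂, h₂⟩ := exists_torsionUpTo_bound hdpos hY' (hlt Y' hY' hYX')
  obtain ⟨c₃, hc₃, h₃⟩ := exists_generic_bound hp hpm hBA hC hhom
  refine ⟨c₁ + c₂ + c₃, fun T hT => ?_⟩
  set W := {x | (x ∈ X ∧ x ∉ Y) ∧ monMap A x ∈ properZeros f} with hW
  have hcover : torsionUpTo X T ⊆ torsionUpTo Y T ∪ torsionUpTo Y' T ∪ torsionUpTo W T := by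
    rintro x ⟨hx, hx'⟩
    by_cases hxY : x ∈ Y
    · exact Or.inl (Or.inl ⟨hxY, hx'⟩)
    by_cases hxY' : x ∈ Y'
    · exact Or.inl (Or.inr ⟨hxY', hx'⟩)
    refine Or.inr ⟨⟨⟨hx, hxY⟩, hf x hx, fun s hs hne h0 => hxY' ⟨hx, ?_⟩⟩, hx'⟩
    simp only [Set.mem_ofPred_eq, Q, map_prod]
    refine Finset.prod_eq_zero (Finset.mem_filter.2 ⟨Finset.mem_ssubsets.2 hs, hne⟩) ?_
    rw [eval_pull, map_sum, ← h0]
    exact Finset.sum_congr rfl fun v _ => eval_single _ _ _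
  have hfinite := ((h₁ T hT).1.union (h₂ T hT).1).union (h₃ T hT).1
  refine ⟨hfinite.subset hcover, ?_⟩
  have hnat : (torsionUpTo X T).ncard ≤
      (torsionUpTo Y T).ncard + (torsionUpTo Y' T).ncard + (torsionUpTo W T).ncard :=
    (Set.ncard_le_ncard hcover hfinite).trans ((Set.ncard_union_le _ _).trans
      (Nat.add_le_add_right (Set.ncard_union_le _ _) _))
  have hd0 : (0 : ℝ) ≤ d := by positivity
  have hinv : 1 / ((d : ℝ) + 1) ≤ 1 := by
    rw [div_le_one (by linarith)]
    linarith
  have hexp₁ : T ^ (d : ℝ) ≤ T ^ ((d : ℝ) + 1 - 1 / ((d : ℝ) + 1)) :=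
    Real.rpow_le_rpow_of_exponent_le hT (by linarith)
  have hexp₂ : T ^ ((m : ℝ) + 1 - 1 / ((p : ℝ) + 1)) ≤ T ^ ((d : ℝ) + 1 - 1 / ((d : ℝ) + 1)) := by
    refine Real.rpow_le_rpow_of_exponent_le hT ?_
    have h1 : (m : ℝ) ≤ d := by exact_mod_cast hmd
    have h2 : (p : ℝ) ≤ d := by exact_mod_cast hpm.trans hmd
    have h3 : 1 / ((d : ℝ) + 1) ≤ 1 / ((p : ℝ) + 1) :=
      one_div_le_one_div_of_le (by positivity) (by linarith)
    linarith
  calc ((torsionUpTo X T).ncard : ℝ)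
      ≤ (torsionUpTo Y T).ncard + (torsionUpTo Y' T).ncard + (torsionUpTo W T).ncard := by
        exact_mod_cast hnat
    _ ≤ c₁ * T ^ (d : ℝ) + c₂ * T ^ (d : ℝ) + c₃ * T ^ ((m : ℝ) + 1 - 1 / ((p : ℝ) + 1)) :=
        add_le_add (add_le_add (h₁ T hT).2 (h₂ T hT).2) (h₃ T hT).2
    _ ≤ c₁ * T ^ ((d : ℝ) + 1 - 1 / ((d : ℝ) + 1)) + c₂ * T ^ ((d : ℝ) + 1 - 1 / ((d : ℝ) + 1)) +
        c₃ * T ^ ((d : ℝ) + 1 - 1 / ((d : ℝ) + 1)) := by gcongr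
    _ = (c₁ + c₂ + c₃) * T ^ ((d : ℝ) + 1 - 1 / ((d : ℝ) + 1)) := by ring

end GmTorsion

theorem theorem7 {K : Type*} [Field K] [IsAlgClosed K] {n : ℕ}
    (X : Set (GmTorsion.Torus n K)) (halg : GmTorsion.IsAlgebraic X) (hirr : IsIrreducible X)
    (hadm : GmTorsion.IsAdmissible X) (d : ℕ) (hd : GmTorsion.dim X = d) :
    ∃ c : ℝ, ∀ T : ℝ, 1 ≤ T →
      (GmTorsion.torsionUpTo X T).Finite ∧
        ((GmTorsion.torsionUpTo X T).ncard : ℝ) ≤ c * T ^ ((d : ℝ) + 1 - 1 / ((d : ℝ) + 1)) := by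
  -- The finite case stands apart because X may be a single torsion point, itself a torsion coset.
  rcases hadm with hfin | ⟨-, hadm⟩
  · have hd0 : (0 : ℝ) ≤ d := by positivity
    have hinv : 1 / ((d : ℝ) + 1) ≤ 1 := by
      rw [div_le_one (by linarith)]
      linarith
    refine ⟨X.ncard, fun T hT => ⟨hfin.subset fun x hx => hx.1, ?_⟩⟩
    have h0 : GmTorsion.torsionUpTo X T ⊆ X := fun x hx => hx.1
    have h1 : ((GmTorsion.torsionUpTo X T).ncard : ℝ) ≤ X.ncard := by
      exact_mod_cast Set.ncard_le_ncard h0 hfin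
    exact h1.trans (le_mul_of_one_le_right (by positivity)
      (Real.one_le_rpow hT (by linarith)))
  · by_cases htor : ∃ ζ ∈ X, IsOfFinOrder ζ
    · obtain ⟨ζ, hζ, hfin⟩ := htor
      -- Admissibility is applied only to the coset C = X.
      exact GmTorsion.exists_torsion_count ((GmTorsion.isClosed_iff X).2 halg) hirr
        (fun h => hadm X h subset_rfl rfl) hd hζ hfin
    · push Not at htor
      refine ⟨0, fun T _ => ?_⟩
      have hempty : GmTorsion.torsionUpTo X T = ∅ :=
        Set.eq_empty_iff_forall_notMem.2 fun x hx => htor x hx.1 hx.2.1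
      rw [hempty]
      simp
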